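/- Let $N_t>2$, $P>0$, $\sigma>0$, $R_{\mathrm{th}}>0$, $c>0$ and $\varepsilon=2^{R_{\mathrm{th}}}-1$. Let $\mathbf h_1,\mathbf h_2\sim\mathcal{CN}(\mathbf 0,\mathbf I_{N_t})$ be independent (Rayleigh channels), and let $\mathbf c_1,\dots,\mathbf c_{2^{B'}}$ be a random vector quantization codebook: independent vectors, uniformly distributed on the unit sphere of $\mathbb C^{N_t}$ and independent of the channels. User $k$ selects $\mathbf w_k=\mathbf c_{j_k}$ with $j_k\in\arg\max_j|\mathbf h_k^H\mathbf c_j|^2$ and feeds back $j_k$ and $\hat H_{kk}=q(|\mathbf h_k^H\mathbf w_k|^2)$, where $q$ is the $B$-bit uniform quantizer with step $\delta$, $0<\delta\le c\,2^{-B}$: $q(x)=\lfloor x/\delta\rfloor\delta$ for $x<(2^B-1)\delta$ and $q(x)=(2^B-1)\delta$ otherwise. Put $\hat H_{ij}=\hat H_{ii}|\mathbf w_i^H\mathbf w_j|^2$ for $i\ne j$, and, for full CSI, $H_i=\|\mathbf h_i\|^2$ and $H^*_{ij}=|\mathbf h_i^H\mathbf h_j|^2/\|\mathbf h_j\|^2$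 for $i\ne j$. For gains $G=(G_{11},G_{12},G_{21},G_{22})$ let $$R(G;\beta)=\log_2\Bigl(1+\frac{\beta PG_{11}}{\sigma^2}\Bigr)+\log_2\Bigl(1+\frac{(1-\beta)PG_{22}}{\beta PG_{21}+\sigma^2}\Bigr)$$ be the sum rate when user 1 (the strong user, which performs successive interference cancellation) receives power $\beta P$ and user 2 receives $(1-\beta)P$, and let $\mathcal B(G)$ be the set of feasible $\beta$, i.e. $$\max\Bigl\{0,\frac{\varepsilon\sigma^2}{PG_{11}}\Bigr\}\le\beta\le\min\Bigl\{\frac{PG_{22}-\varepsilon\sigma^2}{PG_{22}+\varepsilon PG_{21}},\ \frac{PG_{12}-\varepsilon\sigma^2}{PG_{12}+\varepsilon PG_{11}},\ 1\Bigr\}.$$ Let $G^*=(H_1,H^*_{12},H^*_{21},H_2)$, $\hat G=(\hat H_{11},\hat H_{12},\hat H_{21},\hat H_{22})$, and let $A$ be the event that NOMA is feasible both with full CSI and with limited feedback ($\mathcal B(G^*)\neq\emptyset$ and $\mathcal B(\hat G)\ne\emptyset$) and that $\delta<|\mathbf h_k^H\mathbf w_k|^2<(2^B-1)\delta$ for $k=1,2$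 (no quantizer saturation). On $A$ let $\beta^*\in\arg\max_{\beta\in\mathcal B(G^*)}R(G^*;\beta)$, $\beta_q\in\arg\max_{\beta\in\mathcal B(\hat G)}R(\hat G;\beta)$ and $\Delta\beta=\beta_q-\beta^*$. Then the loss induced by $|\Delta\beta|$ converges to $0$ at least exponentially as $B$ and $B'$ increase: there is a constant $K>0$, depending only on $N_t,P,\sigma,R_{\mathrm{th}},c$, such that for all $B,B'\ge 0$, all such $\delta$ and all choices of the maximizers, each of the three expectations $$\mathbb E\bigl[|\Delta\beta|\,\mathbf 1_A\bigr],\qquad \mathbb E\bigl[(H_1+H_2)|\Delta\beta|\,\mathbf 1_A\bigr],\qquad \mathbb E\bigl[\,|R(G^*;\beta^*)-R(G^*;\beta_q)|\,\mathbf 1_A\bigr]$$ is at most $K\bigl(2^{-B}+2^{-B'/(2(N_t-1))}\bigr)$. -/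

import Mathlib

open MeasureTheory ProbabilityTheory

noncomputable section

namespace MisoNoma

/-- The space `ℂᴺ` of channel and precoding vectors, with the Euclidean norm and the Hermitian
inner product `inner ℂ x y = xᴴ y`. -/
abbrev Vec (N : ℕ) : Type := EuclideanSpace ℂ (Fin N)

/-- The circularly symmetric complex Gaussian law `𝒞𝒩(0, 1)`: independent real and imaginary
parts, each centred Gaussian of variance `1/2`. -/
def complexGaussian : Measure ℂ :=
  ((gaussianReal 0 (1 / 2)).prod (gaussianReal 0 (1 / 2))).map fun p : ℝ × ℝ => ⟨p.1, p.2⟩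

/-- Rayleigh fading: the law `𝒞𝒩(0, I_N)` of a channel vector. -/
def rayleigh (N : ℕ) : Measure (Vec N) :=
  (Measure.pi fun _ : Fin N => complexGaussian).map (WithLp.toLp 2)

/-- The isotropic (uniform) law on the unit sphere of `ℂᴺ`, realised as the law of the direction
of a `𝒞𝒩(0, I_N)` vector. -/
def isotropic (N : ℕ) : Measure (Vec N) :=
  (rayleigh N).map fun g => ((‖g‖⁻¹ : ℝ) : ℂ) • g

/-- One realisation: the channel vectors of the two users (index `0` is user 1, the strong user,
which performs SIC; index `1` is user 2, the weak user), and the codebook of `2 ^ B'`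
precoding vectors shared by the base station and both users. -/
abbrev Sample (N B' : ℕ) : Type := (Fin 2 → Vec N) × (Fin (2 ^ B') → Vec N)

/-- The joint law: independent Rayleigh channels and, independently of them, a random vector
quantization codebook, i.e. `2 ^ B'` independent isotropic unit vectors. -/
def sampleLaw (N B' : ℕ) : Measure (Sample N B') :=
  (Measure.pi fun _ : Fin 2 => rayleigh N).prod
    (Measure.pi fun _ : Fin (2 ^ B') => isotropic N)

/-- The gain `|hᴴ w|²` of the channel `h` along the precoding vector `w`. -/
def gain {N : ℕ} (h w : Vec N) : ℝ := ‖inner ℂ h w‖ ^ 2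

/-- The uniform `B`-bit quantizer with step `δ`. -/
def quantizer (B : ℕ) (δ x : ℝ) : ℝ :=
  if x < (2 ^ B - 1) * δ then (⌊x / δ⌋ : ℝ) * δ else (2 ^ B - 1) * δ

/-- The system constants: total power `P`, noise standard deviation `σ` and the rate threshold
`Rth` of the quality-of-service constraint. -/
structure Params where
  P : ℝ
  σ : ℝ
  Rth : ℝ

/-- The SINR threshold `ε = 2 ^ Rth - 1`. -/
def Params.ε (p : Params) : ℝ := (2 : ℝ) ^ p.Rth - 1

/-- The four power gains that enter the rates: `Hij` is the gain of the channel of user `i` along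
the precoding vector of user `j`. -/
structure Gains where
  H11 : ℝ
  H12 : ℝ
  H21 : ℝ
  H22 : ℝ

/-- The gains under full CSI, where the precoding vectors are `h₁ / ‖h₁‖` and `h₂ / ‖h₂‖`. -/
def fullGains {N : ℕ} (h : Fin 2 → Vec N) : Gains where
  H11 := ‖h 0‖ ^ 2
  H12 := gain (h 0) (((‖h 1‖⁻¹ : ℝ) : ℂ) • h 1)
  H21 := gain (h 1) (((‖h 0‖⁻¹ : ℝ) : ℂ) • h 0)
  H22 := ‖h 1‖ ^ 2

/-- The gains estimated by the base station from the limited feedback: `Ĥᵢᵢ = q(|hᵢᴴ wᵢ|²)` and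
`Ĥᵢⱼ = Ĥᵢᵢ |wᵢᴴ wⱼ|²` for `i ≠ j`, where `w` are the precoding vectors fed back. -/
def fedBackGains {N : ℕ} (B : ℕ) (δ : ℝ) (h w : Fin 2 → Vec N) : Gains where
  H11 := quantizer B δ (gain (h 0) (w 0))
  H12 := quantizer B δ (gain (h 0) (w 0)) * gain (w 0) (w 1)
  H21 := quantizer B δ (gain (h 1) (w 1)) * gain (w 1) (w 0)
  H22 := quantizer B δ (gain (h 1) (w 1))

/-- The sum rate `log₂ (1 + SINR₁) + log₂ (1 + SINR₂)` when the fraction `β` of the power goes to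
user 1. -/
def sumRate (p : Params) (g : Gains) (β : ℝ) : ℝ :=
  Real.logb 2 (1 + β * p.P * g.H11 / p.σ ^ 2) +
    Real.logb 2 (1 + (1 - β) * p.P * g.H22 / (β * p.P * g.H21 + p.σ ^ 2))

/-- `β_{1,min}`. -/
def beta1Min (p : Params) (g : Gains) : ℝ := p.ε * p.σ ^ 2 / (p.P * g.H11)

/-- `β_{2,max}`. -/
def beta2Max (p : Params) (g : Gains) : ℝ :=
  (p.P * g.H22 - p.ε * p.σ ^ 2) / (p.P * g.H22 + p.ε * p.P * g.H21)

/-- `β_{SIC,max}`. -/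
def betaSicMax (p : Params) (g : Gains) : ℝ :=
  (p.P * g.H12 - p.ε * p.σ ^ 2) / (p.P * g.H12 + p.ε * p.P * g.H11)

/-- The set of feasible power allocations. NOMA is feasible when it is nonempty. -/
def feasible (p : Params) (g : Gains) : Set ℝ :=
  {β | max 0 (beta1Min p g) ≤ β ∧ β ≤ min (min (beta2Max p g) (betaSicMax p g)) 1}

/-- `β` is a feasible power allocation of maximal sum rate. -/
def IsOptimal (p : Params) (g : Gains) (β : ℝ) : Prop :=
  β ∈ feasible p g ∧ ∀ β' ∈ feasible p g, sumRate p g β' ≤ sumRate p g β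

/-- `j` is a maximum-ratio-transmission selection: in every realisation, user `k` feeds back the
index of a codeword that maximises `|h_kᴴ c|²`. -/
def IsMRTSelection {N B' : ℕ} (j : Sample N B' → Fin 2 → Fin (2 ^ B')) : Prop :=
  ∀ (ω : Sample N B') (k : Fin 2) (i : Fin (2 ^ B')),
    gain (ω.1 k) (ω.2 i) ≤ gain (ω.1 k) (ω.2 (j ω k))

/-- The precoding vectors `w_k = c_{j_k}`. -/
def precoder {N B' : ℕ} (j : Sample N B' → Fin 2 → Fin (2 ^ B')) (ω : Sample N B') :
    Fin 2 → Vec N :=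
  fun k => ω.2 (j ω k)

/-- The gains estimated by the base station in the realisation `ω`. -/
def hatGains {N B' : ℕ} (B : ℕ) (δ : ℝ) (j : Sample N B' → Fin 2 → Fin (2 ^ B'))
    (ω : Sample N B') : Gains :=
  fedBackGains B δ ω.1 (precoder j ω)

/-- The realisations over which the rate loss is evaluated: NOMA is feasible both with full CSI and
with limited feedback, and the effective gains `|h_kᴴ w_k|²` of both users lie in the granular
range `(δ, (2 ^ B - 1) δ)` of the quantizer. No ordering of the two effective gains is imposed, so
a bound over this set is in particular one over its part where user 1 has the larger gain. -/
def region {N B' : ℕ} (p : Params) (B : ℕ) (δ : ℝ) (j : Sample N B' → Fin 2 → Fin (2 ^ B')) :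
    Set (Sample N B') :=
  {ω | (feasible p (fullGains ω.1)).Nonempty ∧ (feasible p (hatGains B δ j ω)).Nonempty ∧
    ∀ k, δ < gain (ω.1 k) (precoder j ω k) ∧
      gain (ω.1 k) (precoder j ω k) < (2 ^ B - 1) * δ}

/-- The expectation `𝔼[X ; A]`, with values in `[0, ∞]`, of a nonnegative `X` over the event `A`. -/
def meanOn {N B' : ℕ} (A : Set (Sample N B')) (X : Sample N B' → ℝ) : ENNReal :=
  ∫⁻ ω, A.indicator (fun ω => ENNReal.ofReal (X ω)) ω ∂(sampleLaw N B')

end MisoNoma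

end

/-! Full CSI and limited feedback lead to the same deterministic problem. Both gain vectors have the
form `corrGains a b ρ`, so up to the constants `P`, `σ`, `ε` everything depends on the
noise-to-signal ratios `X`, `Y` of the two users and the squared correlation `ρ` of the two beams.
The proof is a Lipschitz estimate for the maximiser in `(X, Y, ρ)`, followed by an average of the
perturbation of `(X, Y, ρ)`.

Deterministic part. For `β < β'` the sign of the rate increment is that of the polynomial `rateSlope
X Y ρ β β'`. It is Lipschitz in the parameters and decreases in the power fractions at rate at least
`κ = Y * (1 - ρ)`. The endpoints of the feasible interval are Lipschitz as well, because feasibility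
forces `ε * X ≤ 1` and `ε * Y ≤ 1`. Comparing the optimality conditions of the two maximisers at a
common point (`argmax_sub_le`) gives `|Δβ| ≤ C * (1 + 1 / κ) * D`, where `D` is the distance between
the two parameter triples. Quantization of the gains and of the directions makes `D` at most a
constant times `δ` plus the sines of the angles between channels and beams (`abs_nsr_sub_le`,
`abs_gain_sub_corr_le`).

Probabilistic part. The factor `1 / κ` is a multiple of `‖h 1‖ ^ 4 / distSq (h 0) (h 1)`. With more
than two antennas `distSq` has a finite moment of order `-3/2`, so Young's inequality and Gaussian
moments give an integrable `weight` that depends on the channels only. For fixed channels the best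
of `2 ^ B'` independent isotropic codewords has mean sine of order `2 ^ (-B' / (2 * (N - 1)))`,
since one codeword lies within sine `t` with probability at least of order `t ^ (2 * (N - 1))`.
Integrating first over the codebook and then over the channels gives the rate
(`lintegral_sampleLaw_le`). -/

namespace MisoNoma

/-! ### The sum rate in terms of noise-to-signal ratios and correlation. -/

/-- The gains of two channels of squared norms `a`, `b` whose precoding directions have squared
correlation `ρ`. -/
noncomputable def corrGains (a b ρ : ℝ) : Gains := ⟨a, a * ρ, b * ρ, b⟩

/-- The divided difference, between `β` and `β'`, that decides the sign of
`sumRate β' - sumRate β`; `X` and `Y` are the noise-to-signal ratios of the two users. -/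
noncomputable def rateSlope (X Y ρ β β' : ℝ) : ℝ :=
  Y * (Y + 1) - X * Y * (1 - ρ) - X * (Y + 1) * ρ - Y * (1 - ρ) * (β + β') - (1 - ρ) * ρ * (β * β')

/-- The noise-to-signal ratio of a channel of gain `a`. -/
noncomputable def Params.nsr (p : Params) (a : ℝ) : ℝ := p.σ ^ 2 / (p.P * a)

lemma Params.nsr_pos {p : Params} (hP : 0 < p.P) (hσ : 0 < p.σ) {a : ℝ} (ha : 0 < a) :
    0 < p.nsr a := by
  unfold Params.nsr; positivity

lemma Params.ε_pos {p : Params} (hR : 0 < p.Rth) : 0 < p.ε := by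
  have : (1 : ℝ) < 2 ^ p.Rth := Real.one_lt_rpow (by norm_num) hR
  unfold Params.ε; linarith

section rate

variable {p : Params} {a b ρ β β' : ℝ}

lemma sumRate_corrGains (hP : 0 < p.P) (hσ : 0 < p.σ) (ha : 0 < a) (hb : 0 < b) (hρ : 0 ≤ ρ)
    (hβ : 0 ≤ β) (hβ1 : β ≤ 1) :
    sumRate p (corrGains a b ρ) β =
      Real.logb 2 ((p.nsr a + β) * (p.nsr b + 1 - β * (1 - ρ)) /
        (p.nsr a * (p.nsr b + β * ρ))) := by
  have hX := Params.nsr_pos hP hσ ha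
  have hY := Params.nsr_pos hP hσ hb
  have h1 : 1 + β * p.P * a / p.σ ^ 2 = (p.nsr a + β) / p.nsr a := by
    unfold Params.nsr; field_simp
  have hd : 0 < β * p.P * (b * ρ) + p.σ ^ 2 := by positivity
  have hd' : 0 < p.σ ^ 2 + β * ρ * (p.P * b) := by positivity
  have h2 : 1 + (1 - β) * p.P * b / (β * p.P * (b * ρ) + p.σ ^ 2) =
      (p.nsr b + 1 - β * (1 - ρ)) / (p.nsr b + β * ρ) := by
    have e1 : p.nsr b + β * ρ = (p.σ ^ 2 + β * ρ * (p.P * b)) / (p.P * b) := by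
      unfold Params.nsr; field_simp
    have e2 : p.nsr b + 1 - β * (1 - ρ) =
        (p.σ ^ 2 + (1 - β * (1 - ρ)) * (p.P * b)) / (p.P * b) := by
      unfold Params.nsr; field_simp; ring
    rw [e1, e2, div_div_div_cancel_right₀ (by positivity), eq_div_iff hd'.ne']
    field_simp
    ring
  have hn : 0 < p.nsr b + 1 - β * (1 - ρ) := by nlinarith
  have hdd : 0 < p.nsr b + β * ρ := by positivity
  simp only [sumRate, corrGains]
  rw [h1, h2, ← Real.logb_mul (by positivity) (by positivity), div_mul_div_comm]

lemma sumRate_le_iff_rateSlope_nonpos (hP : 0 < p.P) (hσ : 0 < p.σ) (ha : 0 < a) (hb : 0 < b)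
    (hρ : 0 ≤ ρ) (hβ : 0 ≤ β) (h : β < β') (hβ1 : β' ≤ 1) :
    (sumRate p (corrGains a b ρ) β' ≤ sumRate p (corrGains a b ρ) β ↔
      rateSlope (p.nsr a) (p.nsr b) ρ β β' ≤ 0) ∧
    (sumRate p (corrGains a b ρ) β ≤ sumRate p (corrGains a b ρ) β' ↔
      0 ≤ rateSlope (p.nsr a) (p.nsr b) ρ β β') := by
  have hX := Params.nsr_pos hP hσ ha
  have hY := Params.nsr_pos hP hσ hb
  rw [sumRate_corrGains hP hσ ha hb hρ hβ (by linarith),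
    sumRate_corrGains hP hσ ha hb hρ (by linarith) hβ1]
  set X := p.nsr a
  set Y := p.nsr b
  have hβ' : 0 ≤ β' := by linarith
  have hn : 0 < Y + 1 - β * (1 - ρ) := by nlinarith
  have hn' : 0 < Y + 1 - β' * (1 - ρ) := by nlinarith
  have hd : 0 < Y + β * ρ := by positivity
  have hd' : 0 < Y + β' * ρ := by positivity
  -- After cross-multiplication the difference of the two arguments of the logarithm is divisible by
  -- `β' - β`; the cofactor is `X * rateSlope`.
  have key : (X + β') * (Y + 1 - β' * (1 - ρ)) * (X * (Y + β * ρ)) -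
      (X + β) * (Y + 1 - β * (1 - ρ)) * (X * (Y + β' * ρ)) =
      (X * (β' - β)) * rateSlope X Y ρ β β' := by
    unfold rateSlope; ring
  have hpos : 0 < X * (β' - β) := mul_pos hX (by linarith)
  constructor
  · rw [Real.logb_le_logb (by norm_num) (by positivity) (by positivity),
      div_le_div_iff₀ (by positivity) (by positivity), ← sub_nonpos, key]
    exact ⟨fun h => nonpos_of_mul_nonpos_right h hpos, fun h => mul_nonpos_of_nonneg_of_nonpos hpos.le h⟩
  · rw [Real.logb_le_logb (by norm_num) (by positivity) (by positivity),
      div_le_div_iff₀ (by positivity) (by positivity), ← sub_nonneg, key]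
    exact mul_nonneg_iff_of_pos_left hpos

lemma abs_log_sub_log_le {u v : ℝ} (hu : 1 ≤ u) (hv : 1 ≤ v) :
    |Real.log u - Real.log v| ≤ |u - v| := by
  wlog h : v ≤ u generalizing u v
  · rw [abs_sub_comm, abs_sub_comm u]; exact this hv hu (by linarith)
  have hv0 : 0 < v := by linarith
  rw [abs_of_nonneg (sub_nonneg.2 (Real.log_le_log hv0 h)), abs_of_nonneg (sub_nonneg.2 h),
    ← Real.log_div (by linarith) hv0.ne']
  refine (Real.log_le_sub_one_of_pos (by positivity)).trans ?_
  rw [div_sub_one hv0.ne', div_le_iff₀ hv0]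
  nlinarith

/-- The rate is a signed sum of three logarithms of affine functions of the power fraction with
values at least `1`, where `log` is 1-Lipschitz. The absolute slopes `α`, `γ * (1 - ρ)` and `γ * ρ`
add up to `α + γ`, which is proportional to `a + b`. -/
lemma abs_sumRate_sub_le (hP : 0 < p.P) (hσ : 0 < p.σ) (ha : 0 < a) (hb : 0 < b)
    (hρ : 0 ≤ ρ) (hρ1 : ρ ≤ 1) (hβ : 0 ≤ β) (hβ1 : β ≤ 1) (hβ' : 0 ≤ β') (hβ1' : β' ≤ 1) :
    |sumRate p (corrGains a b ρ) β - sumRate p (corrGains a b ρ) β'| ≤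
      p.P / (p.σ ^ 2 * Real.log 2) * ((a + b) * |β - β'|) := by
  set α := p.P * a / p.σ ^ 2 with hα
  set γ := p.P * b / p.σ ^ 2 with hγ
  have hα0 : 0 < α := by positivity
  have hγ0 : 0 < γ := by positivity
  have hl2 : 0 < Real.log 2 := Real.log_pos (by norm_num)
  have hexp : ∀ x, 0 ≤ x → x ≤ 1 → sumRate p (corrGains a b ρ) x =
      (Real.log (1 + x * α) + (Real.log (1 + γ * (1 - x * (1 - ρ))) - Real.log (1 + x * (γ * ρ))))
        / Real.log 2 := by
    intro x hx hx1
    have h3 : 0 ≤ 1 - x * (1 - ρ) := by nlinarith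
    have h1 : 1 + x * p.P * a / p.σ ^ 2 = 1 + x * α := by rw [hα]; ring
    have h2 : 1 + (1 - x) * p.P * b / (x * p.P * (b * ρ) + p.σ ^ 2) =
        (1 + γ * (1 - x * (1 - ρ))) / (1 + x * (γ * ρ)) := by
      have : 0 < x * p.P * (b * ρ) + p.σ ^ 2 := by positivity
      have e : 1 + x * (γ * ρ) = (x * p.P * (b * ρ) + p.σ ^ 2) / p.σ ^ 2 := by
        rw [hγ]; field_simp; ring
      rw [e, hγ]; field_simp; ring
    simp only [sumRate, corrGains, Real.logb]
    rw [h1, h2, Real.log_div (by positivity) (by positivity)]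
    ring
  rw [hexp β hβ hβ1, hexp β' hβ' hβ1', ← sub_div, abs_div, abs_of_pos hl2]
  have hk : ∀ x, 0 ≤ x → x ≤ 1 → 1 ≤ 1 + γ * (1 - x * (1 - ρ)) := fun x hx hx1 => by
    have h3 : 0 ≤ 1 - x * (1 - ρ) := by nlinarith
    have := mul_nonneg hγ0.le h3
    linarith
  have i1 := abs_log_sub_log_le (u := 1 + β * α) (v := 1 + β' * α)
    (by nlinarith [mul_nonneg hβ hα0.le]) (by nlinarith [mul_nonneg hβ' hα0.le])
  have i2 := abs_log_sub_log_le (hk β hβ hβ1) (hk β' hβ' hβ1')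
  have hγρ : 0 ≤ γ * ρ := by positivity
  have i3 := abs_log_sub_log_le (u := 1 + β * (γ * ρ)) (v := 1 + β' * (γ * ρ))
    (by nlinarith [mul_nonneg hβ hγρ]) (by nlinarith [mul_nonneg hβ' hγρ])
  have e1 : 1 + β * α - (1 + β' * α) = α * (β - β') := by ring
  have e2 : 1 + γ * (1 - β * (1 - ρ)) - (1 + γ * (1 - β' * (1 - ρ))) =
      -(γ * (1 - ρ) * (β - β')) := by ring
  have e3 : 1 + β * (γ * ρ) - (1 + β' * (γ * ρ)) = γ * ρ * (β - β') := by ring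
  rw [e1, abs_mul, abs_of_pos hα0] at i1
  rw [e2, abs_neg, abs_mul, abs_of_nonneg (mul_nonneg hγ0.le (sub_nonneg.2 hρ1))] at i2
  rw [e3, abs_mul, abs_of_nonneg hγρ] at i3
  have hfin : p.P / (p.σ ^ 2 * Real.log 2) * ((a + b) * |β - β'|) =
      (α * |β - β'| + γ * (1 - ρ) * |β - β'| + γ * ρ * |β - β'|) / Real.log 2 := by
    rw [hα, hγ]; field_simp; ring
  rw [hfin]
  gcongr
  rw [abs_le] at *
  constructor <;> linarith [i1.1, i1.2, i2.1, i2.2, i3.1, i3.2]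

end rate

/-! ### The feasible interval and the stability of the optimal power fraction. -/

/-- The largest feasible power fraction of user 1, in terms of the noise-to-signal ratios and the
correlation. -/
noncomputable def betaTop (ε X Y ρ : ℝ) : ℝ :=
  min (min ((1 - ε * Y) / (1 + ε * ρ)) ((ρ - ε * X) / (ρ + ε))) 1

lemma mem_feasible_corrGains {p : Params} {a b ρ β : ℝ} (hP : 0 < p.P) (hσ : 0 < p.σ)
    (hR : 0 < p.Rth) (ha : 0 < a) (hb : 0 < b) (hρ : 0 ≤ ρ) :
    β ∈ feasible p (corrGains a b ρ) ↔
      p.ε * p.nsr a ≤ β ∧ β ≤ betaTop p.ε (p.nsr a) (p.nsr b) ρ := by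
  have hε := p.ε_pos hR
  have hX := Params.nsr_pos hP hσ ha
  have e1 : beta1Min p (corrGains a b ρ) = p.ε * p.nsr a := by
    simp only [beta1Min, corrGains, Params.nsr]; ring
  have e2 : beta2Max p (corrGains a b ρ) = (1 - p.ε * p.nsr b) / (1 + p.ε * ρ) := by
    have : 0 < 1 + p.ε * ρ := by positivity
    have : 0 < p.P * b + p.ε * p.P * (b * ρ) := by positivity
    simp only [beta2Max, corrGains, Params.nsr]
    field_simp
  have e3 : betaSicMax p (corrGains a b ρ) = (ρ - p.ε * p.nsr a) / (ρ + p.ε) := by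
    have : 0 < ρ + p.ε := by positivity
    have : 0 < p.P * (a * ρ) + p.ε * p.P * a := by positivity
    simp only [betaSicMax, corrGains, Params.nsr]
    field_simp
  have e4 : max 0 (p.ε * p.nsr a) = p.ε * p.nsr a := max_eq_right (by positivity)
  rw [feasible, Set.mem_ofPred_eq, e1, e2, e3, e4, betaTop]

section stability

variable {X Y X' Y' ρ ρ' β β' : ℝ}

lemma rateSlope_sub_le {M : ℝ} (hX : 0 ≤ X) (hXM : X ≤ M) (hY : 0 ≤ Y) (hYM : Y ≤ M)
    (hX' : 0 ≤ X') (hXM' : X' ≤ M) (hY' : 0 ≤ Y') (hYM' : Y' ≤ M)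
    (hρ : 0 ≤ ρ) (hρ1 : ρ ≤ 1) (hρ' : 0 ≤ ρ') (hρ1' : ρ' ≤ 1)
    (hβ : 0 ≤ β) (hβ1 : β ≤ 1) (hβ' : 0 ≤ β') (hβ1' : β' ≤ 1) :
    |rateSlope X Y ρ β β' - rateSlope X' Y' ρ' β β'| ≤
      (3 * M + 4) * (|X - X'| + |Y - Y'| + |ρ - ρ'|) := by
  -- The parameters are changed one at a time: `X`, then `Y`, then `ρ`.
  have e : rateSlope X Y ρ β β' - rateSlope X' Y' ρ' β β' =
      (X - X') * (-(Y + ρ)) +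
      (Y - Y') * (Y + Y' + 1 - X' - (1 - ρ) * (β + β')) +
      (ρ - ρ') * (-X' + Y' * (β + β') + (ρ + ρ' - 1) * (β * β')) := by
    unfold rateSlope; ring
  have hbb : β * β' ≤ 1 := mul_le_one₀ hβ1 hβ' hβ1'
  have hbb0 : 0 ≤ β * β' := mul_nonneg hβ hβ'
  have b1 : |-(Y + ρ)| ≤ 3 * M + 4 := by
    rw [abs_neg, abs_of_nonneg (by linarith)]; linarith
  have b2 : |Y + Y' + 1 - X' - (1 - ρ) * (β + β')| ≤ 3 * M + 4 := by
    have : (1 - ρ) * (β + β') ≤ 2 := by nlinarith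
    have : 0 ≤ (1 - ρ) * (β + β') := mul_nonneg (by linarith) (by linarith)
    rw [abs_le]; constructor <;> linarith
  have b3 : |-X' + Y' * (β + β') + (ρ + ρ' - 1) * (β * β')| ≤ 3 * M + 4 := by
    have : Y' * (β + β') ≤ 2 * M := by nlinarith
    have : 0 ≤ Y' * (β + β') := mul_nonneg hY' (by linarith)
    have : (ρ + ρ' - 1) * (β * β') ≤ 1 := by nlinarith
    have : -1 ≤ (ρ + ρ' - 1) * (β * β') := by nlinarith
    rw [abs_le]; constructor <;> linarith
  rw [e]
  refine (abs_add_le _ _).trans ((add_le_add (abs_add_le _ _) le_rfl).trans ?_)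
  rw [abs_mul, abs_mul, abs_mul]
  nlinarith [mul_le_mul_of_nonneg_left b1 (abs_nonneg (X - X')),
    mul_le_mul_of_nonneg_left b2 (abs_nonneg (Y - Y')),
    mul_le_mul_of_nonneg_left b3 (abs_nonneg (ρ - ρ'))]

/-- The denominators stay above `1` and `ε`, the bounds on `ε * Y'` and `ε * X` control the
numerators, and `min` is 1-Lipschitz for the maximum of the differences. -/
lemma betaTop_sub_le {ε : ℝ} (hε : 0 < ε) (hY' : 0 ≤ Y') (hY1' : ε * Y' ≤ 1)
    (hX : 0 ≤ X) (hX1 : ε * X ≤ 1) (hρ : 0 ≤ ρ) (hρ' : 0 ≤ ρ') :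
    |betaTop ε X Y ρ - betaTop ε X' Y' ρ'| ≤
      (2 + 2 * ε + 2 / ε + 1 / ε ^ 2) * (|X - X'| + |Y - Y'| + |ρ - ρ'|) := by
  have h1 : |(1 - ε * Y) / (1 + ε * ρ) - (1 - ε * Y') / (1 + ε * ρ')| ≤
      ε * (|Y - Y'| + |ρ - ρ'|) := by
    have hd : 1 ≤ 1 + ε * ρ := by nlinarith [mul_nonneg hε.le hρ]
    have hd' : 1 ≤ 1 + ε * ρ' := by nlinarith [mul_nonneg hε.le hρ']
    have e : (1 - ε * Y) / (1 + ε * ρ) - (1 - ε * Y') / (1 + ε * ρ') =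
        (-(ε * (Y - Y')) - ε * (ρ - ρ') * ((1 - ε * Y') / (1 + ε * ρ'))) / (1 + ε * ρ) := by
      have : 1 + ε * ρ ≠ 0 := by linarith
      have : 1 + ε * ρ' ≠ 0 := by linarith
      field_simp; ring
    have hq : |(1 - ε * Y') / (1 + ε * ρ')| ≤ 1 := by
      rw [abs_of_nonneg (div_nonneg (by linarith) (by linarith)), div_le_one (by linarith)]
      nlinarith [mul_nonneg hε.le hY']
    rw [e, abs_div, abs_of_pos (show 0 < 1 + ε * ρ by linarith)]
    refine (div_le_self (abs_nonneg _) hd).trans ((abs_sub _ _).trans ?_)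
    rw [abs_neg, abs_mul, abs_mul, abs_mul, abs_of_pos hε, mul_add]
    exact add_le_add le_rfl (mul_le_of_le_one_right (by positivity) hq)
  have h2 : |(ρ - ε * X) / (ρ + ε) - (ρ' - ε * X') / (ρ' + ε)| ≤
      |X - X'| + (1 / ε + 1 / ε ^ 2) * |ρ - ρ'| := by
    have hd : ε ≤ ρ + ε := by linarith
    have hd' : ε ≤ ρ' + ε := by linarith
    have e : (ρ - ε * X) / (ρ + ε) - (ρ' - ε * X') / (ρ' + ε) =
        -((X - X') * (ε / (ρ' + ε))) + (ρ - ρ') * (ε * (1 + X) / ((ρ + ε) * (ρ' + ε))) := by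
      have : ρ + ε ≠ 0 := by linarith
      have : ρ' + ε ≠ 0 := by linarith
      field_simp; ring
    rw [e]
    refine (abs_add_le _ _).trans ?_
    rw [abs_neg, abs_mul, abs_mul]
    have q1 : |ε / (ρ' + ε)| ≤ 1 := by
      rw [abs_of_pos (by positivity), div_le_one (by positivity)]; exact hd'
    have hX2 : X ≤ 1 / ε := by rw [le_div_iff₀ hε]; linarith
    have q2 : |ε * (1 + X) / ((ρ + ε) * (ρ' + ε))| ≤ 1 / ε + 1 / ε ^ 2 := by
      rw [abs_of_nonneg (by positivity)]
      calc ε * (1 + X) / ((ρ + ε) * (ρ' + ε)) ≤ ε * (1 + 1 / ε) / (ε * ε) := by gcongr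
        _ = 1 / ε + 1 / ε ^ 2 := by field_simp
    rw [mul_comm (1 / ε + 1 / ε ^ 2)]
    exact add_le_add (mul_le_of_le_one_right (abs_nonneg _) q1)
      (mul_le_mul_of_nonneg_left q2 (abs_nonneg _))
  have h3 := abs_min_sub_min_le_max ((1 - ε * Y) / (1 + ε * ρ)) ((ρ - ε * X) / (ρ + ε))
    ((1 - ε * Y') / (1 + ε * ρ')) ((ρ' - ε * X') / (ρ' + ε))
  have h4 := abs_min_sub_min_le_max (min ((1 - ε * Y) / (1 + ε * ρ)) ((ρ - ε * X) / (ρ + ε))) 1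
    (min ((1 - ε * Y') / (1 + ε * ρ')) ((ρ' - ε * X') / (ρ' + ε))) 1
  rw [sub_self, abs_zero, max_eq_left (abs_nonneg _)] at h4
  refine h4.trans (h3.trans ?_)
  have a1 := abs_nonneg (X - X')
  have a2 := abs_nonneg (Y - Y')
  have a3 := abs_nonneg (ρ - ρ')
  have i1 : 0 < 1 / ε := by positivity
  have i2 : 0 < 1 / ε ^ 2 := by positivity
  have i3 : 2 / ε = 2 * (1 / ε) := by ring
  rw [i3]
  refine max_le (h1.trans ?_) (h2.trans ?_)
  · nlinarith [mul_nonneg i1.le a1, mul_nonneg i1.le a2, mul_nonneg i1.le a3,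
      mul_nonneg i2.le a1, mul_nonneg i2.le a2, mul_nonneg i2.le a3,
      mul_nonneg hε.le a1, mul_nonneg hε.le a2, mul_nonneg hε.le a3]
  · nlinarith [mul_nonneg i1.le a1, mul_nonneg i1.le a2, mul_nonneg i1.le a3,
      mul_nonneg i2.le a1, mul_nonneg i2.le a2, mul_nonneg i2.le a3,
      mul_nonneg hε.le a1, mul_nonneg hε.le a2, mul_nonneg hε.le a3]

/-- If `e` and `e'` are divided differences of two functions whose maximisers over `[l, u]` and
`[l', u']` are `x` and `x'`, and `e` is strictly decreasing at rate `κ`, then the maximisers are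
close. -/
lemma argmax_sub_le {e e' : ℝ → ℝ → ℝ} {l u l' u' x x' κ η : ℝ}
    (hκ : 0 ≤ κ) (hη : 0 ≤ η) (hlx : l ≤ x) (hxu' : x' ≤ u')
    (hopt : ∀ y, x < y → y ≤ u → e x y ≤ 0) (hopt' : ∀ y, l' ≤ y → y < x' → 0 ≤ e' y x')
    (hdec : ∀ m, l ≤ m → m ≤ x' → x ≤ x' → e m x' ≤ e x m - κ * (x' - x))
    (hclose : ∀ y, l' ≤ y → y ≤ x' → e' y x' ≤ e y x' + η) :
    κ * (x' - x) ≤ κ * (|l - l'| + |u - u'|) + η := by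
  have a1 := neg_abs_le (l - l')
  have a2 := neg_abs_le (u - u')
  have a3 := abs_nonneg (l - l')
  have a4 := abs_nonneg (u - u')
  -- If no point lies strictly between `max x l'` and `min x' u`, then `x' - x` is at most the
  -- displacement of the endpoints. Otherwise an intermediate `m` is feasible for both problems and
  -- is compared with `x` in the first and with `x'` in the second.
  rcases le_or_gt (min x' u) (max x l') with h | h
  · have : x' - x ≤ |l - l'| + |u - u'| := by
      rcases min_le_iff.1 h with h | h <;> rcases le_max_iff.1 h with h | h <;> linarith
    nlinarith
  · obtain ⟨⟨h1, h2⟩, h3, h4⟩ : (x < x' ∧ l' < x') ∧ x < u ∧ l' < u := by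
      simpa [lt_min_iff, max_lt_iff] using h
    obtain ⟨m, hm1, hm2⟩ := exists_between h
    rw [max_lt_iff] at hm1
    rw [lt_min_iff] at hm2
    have i1 := hopt m hm1.1 hm2.2.le
    have i2 := hopt' m hm1.2.le hm2.1
    have i3 := hdec m (by linarith) hm2.1.le h1.le
    have i4 := hclose m hm1.2.le hm2.1.le
    nlinarith [mul_nonneg hκ (add_nonneg a3 a4)]

/-- `rateSlope` is symmetric and affine in each power fraction, so both sides share the argument
`m`. Only the part `Y * (1 - ρ)` of the decay is kept; it degenerates at `ρ = 1`, where `rateSlope`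
does not depend on the power fractions. -/
lemma rateSlope_le_sub {m : ℝ} (hρ : 0 ≤ ρ) (hρ1 : ρ ≤ 1) (hm : 0 ≤ m) (h : β ≤ β') :
    rateSlope X Y ρ m β' ≤ rateSlope X Y ρ β m - Y * (1 - ρ) * (β' - β) := by
  have h4 : 0 ≤ (1 - ρ) * ρ * m * (β' - β) :=
    mul_nonneg (mul_nonneg (mul_nonneg (by linarith) hρ) hm) (by linarith)
  have e : rateSlope X Y ρ m β' = rateSlope X Y ρ β m - Y * (1 - ρ) * (β' - β) -
      (1 - ρ) * ρ * m * (β' - β) := by unfold rateSlope; ring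
  linarith

lemma betaTop_le_one (ε X Y ρ : ℝ) : betaTop ε X Y ρ ≤ 1 := min_le_right _ _

lemma mul_le_one_of_betaTop_nonneg {ε : ℝ} (hε : 0 < ε) (hρ : 0 ≤ ρ) (h : 0 ≤ betaTop ε X Y ρ) :
    ε * Y ≤ 1 := by
  have h1 := h.trans ((min_le_left _ _).trans (min_le_left _ _))
  have hd : 0 < 1 + ε * ρ := by positivity
  rw [div_nonneg_iff] at h1
  rcases h1 with h1 | h1 <;> linarith

/-- Maximisers of two rates, described by the signs of their divided differences, are close. -/
lemma rateSlope_argmax_sub_le {ε : ℝ} (hε : 0 < ε) (hX : 0 < X) (hY : 0 < Y) (hX' : 0 < X')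
    (hY' : 0 < Y') (hρ : 0 ≤ ρ) (hρ1 : ρ ≤ 1) (hρ' : 0 ≤ ρ') (hρ1' : ρ' ≤ 1)
    (hl : ε * X ≤ β) (hu : β ≤ betaTop ε X Y ρ) (hl' : ε * X' ≤ β') (hu' : β' ≤ betaTop ε X' Y' ρ')
    (hright : ∀ y, β < y → y ≤ betaTop ε X Y ρ → rateSlope X Y ρ β y ≤ 0)
    (hleft : ∀ y, ε * X ≤ y → y < β → 0 ≤ rateSlope X Y ρ y β)
    (hright' : ∀ y, β' < y → y ≤ betaTop ε X' Y' ρ' → rateSlope X' Y' ρ' β' y ≤ 0)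
    (hleft' : ∀ y, ε * X' ≤ y → y < β' → 0 ≤ rateSlope X' Y' ρ' y β') :
    Y * (1 - ρ) * |β' - β| ≤ (1 + Y * (1 - ρ)) *
      ((3 * (1 / ε) + 4 + (ε + (2 + 2 * ε + 2 / ε + 1 / ε ^ 2))) *
        (|X - X'| + |Y - Y'| + |ρ - ρ'|)) := by
  have hεX : 0 < ε * X := by positivity
  have hεX' : 0 < ε * X' := by positivity
  have hβ1 := hu.trans (betaTop_le_one _ _ _ _)
  have hβ1' := hu'.trans (betaTop_le_one _ _ _ _)
  have hY1 : ε * Y ≤ 1 := mul_le_one_of_betaTop_nonneg hε hρ ((hεX.le.trans hl).trans hu)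
  have hY1' : ε * Y' ≤ 1 := mul_le_one_of_betaTop_nonneg hε hρ' ((hεX'.le.trans hl').trans hu')
  have toM : ∀ z, ε * z ≤ 1 → z ≤ 1 / ε := fun z hz => by rw [le_div_iff₀ hε]; linarith
  have hκ : 0 ≤ Y * (1 - ρ) := mul_nonneg hY.le (by linarith)
  have hclose := fun x y => rateSlope_sub_le (β := x) (β' := y) hX.le (toM X (hl.trans hβ1)) hY.le
    (toM Y hY1) hX'.le (toM X' (hl'.trans hβ1')) hY'.le (toM Y' hY1') hρ hρ1 hρ' hρ1'
  have htop := betaTop_sub_le (X' := X') (Y := Y) hε hY'.le hY1' hX.le (hl.trans hβ1) hρ hρ'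
  have hbot : |ε * X - ε * X'| ≤ ε * (|X - X'| + |Y - Y'| + |ρ - ρ'|) := by
    rw [← mul_sub, abs_mul, abs_of_pos hε]
    refine mul_le_mul_of_nonneg_left ?_ hε.le
    linarith [abs_nonneg (Y - Y'), abs_nonneg (ρ - ρ')]
  have hC1 : 0 < 3 * (1 / ε) + 4 := by positivity
  have hC2 : 0 < 2 + 2 * ε + 2 / ε + 1 / ε ^ 2 := by positivity
  have hD0 : 0 ≤ |X - X'| + |Y - Y'| + |ρ - ρ'| := by positivity
  have hU := betaTop_le_one ε X Y ρ
  have hU' := betaTop_le_one ε X' Y' ρ'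
  generalize betaTop ε X Y ρ = U at *
  generalize betaTop ε X' Y' ρ' = U' at *
  generalize |X - X'| + |Y - Y'| + |ρ - ρ'| = D at *
  generalize 3 * (1 / ε) + 4 = C1 at *
  generalize 2 + 2 * ε + 2 / ε + 1 / ε ^ 2 = C2 at *
  have hη : 0 ≤ C1 * D := by positivity
  have main1 := argmax_sub_le (e := rateSlope X Y ρ) (e' := rateSlope X' Y' ρ')
    hκ hη hl hu' hright hleft'
    (fun m h1 h2 h3 => rateSlope_le_sub hρ hρ1 (by linarith) h3)
    (fun y h1 h2 => by
      have := (abs_le.1 (hclose y β' (by linarith) (by linarith) (by linarith) hβ1')).1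
      linarith)
  -- The opposite inequality comes from the reflection `β ↦ -β`, which exchanges the roles of the
  -- two endpoints.
  have main2 := argmax_sub_le (e := fun x y => -rateSlope X Y ρ (-y) (-x))
    (e' := fun x y => -rateSlope X' Y' ρ' (-y) (-x))
    (l := -U) (u := -(ε * X)) (l' := -U') (u' := -(ε * X')) (x := -β) (x' := -β')
    (κ := Y * (1 - ρ)) hκ hη (by linarith) (by linarith)
    (fun y h1 h2 => by
      simpa using hleft (-y) (by linarith) (by linarith))
    (fun y h1 h2 => by
      simpa using hright' (-y) (by linarith) (by linarith))
    (fun m h1 h2 h3 => by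
      have h4 : 0 ≤ (1 - ρ) * ρ * (-m) * (β - β') :=
        mul_nonneg (mul_nonneg (mul_nonneg (by linarith) hρ) (by linarith)) (by linarith)
      have e : -rateSlope X Y ρ β' (-m) = -rateSlope X Y ρ (-m) β - Y * (1 - ρ) * (β - β') -
        (1 - ρ) * ρ * (-m) * (β - β') := by unfold rateSlope; ring
      simp only [neg_neg]
      linarith)
    (fun y h1 h2 => by
      have := (abs_le.1 (hclose β' (-y) (by linarith) hβ1' (by linarith) (by linarith))).2
      simp only [neg_neg]
      linarith)
  rw [show -U - -U' = -(U - U') by ring, show -(ε * X) - -(ε * X') = -(ε * X - ε * X') by ring,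
    abs_neg, abs_neg] at main2
  have hm := mul_le_mul_of_nonneg_left (add_le_add hbot htop) hκ
  have key : Y * (1 - ρ) * |β' - β| ≤ Y * (1 - ρ) * (ε * D + C2 * D) + C1 * D := by
    rcases abs_cases (β' - β) with ⟨h, _⟩ | ⟨h, _⟩ <;> rw [h] <;> linarith
  refine key.trans ?_
  have q1 := mul_nonneg hκ hη
  have q2 := mul_nonneg (add_pos hε hC2).le hD0
  have e : (1 + Y * (1 - ρ)) * ((C1 + (ε + C2)) * D) =
    Y * (1 - ρ) * (ε * D + C2 * D) + C1 * D + Y * (1 - ρ) * (C1 * D) + (ε + C2) * D := by ring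
  linarith

end stability

/-- Optimal power allocations depend Lipschitz-continuously on the noise-to-signal ratios and the
correlation, with a constant that degenerates as the correlation tends to `1`. -/
lemma exists_isOptimal_sub_le {p : Params} (hP : 0 < p.P) (hσ : 0 < p.σ) (hR : 0 < p.Rth) :
    ∃ C : ℝ, 0 < C ∧ ∀ a b ρ a' b' ρ' β β' : ℝ, 0 < a → 0 < b → 0 ≤ ρ → ρ ≤ 1 → 0 < a' → 0 < b' →
      0 ≤ ρ' → ρ' ≤ 1 → IsOptimal p (corrGains a b ρ) β → IsOptimal p (corrGains a' b' ρ') β' →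
      p.nsr b * (1 - ρ) * |β' - β| ≤
        (1 + p.nsr b * (1 - ρ)) *
          (C * (|p.nsr a - p.nsr a'| + |p.nsr b - p.nsr b'| + |ρ - ρ'|)) := by
  have hε := p.ε_pos hR
  refine ⟨3 * (1 / p.ε) + 4 + (p.ε + (2 + 2 * p.ε + 2 / p.ε + 1 / p.ε ^ 2)), by positivity, ?_⟩
  have right : ∀ a b ρ β : ℝ, 0 < a → 0 < b → 0 ≤ ρ → IsOptimal p (corrGains a b ρ) β →
      ∀ y, β < y → y ≤ betaTop p.ε (p.nsr a) (p.nsr b) ρ →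
        rateSlope (p.nsr a) (p.nsr b) ρ β y ≤ 0 := by
    intro a b ρ β ha hb hρ ho y h1 h2
    have hmem := fun x => mem_feasible_corrGains (β := x) hP hσ hR ha hb hρ
    have hl := ((hmem β).1 ho.1).1
    have h0 : 0 < p.ε * p.nsr a := mul_pos hε (Params.nsr_pos hP hσ ha)
    exact (sumRate_le_iff_rateSlope_nonpos hP hσ ha hb hρ (by linarith) h1
      (h2.trans (betaTop_le_one _ _ _ _))).1.1 (ho.2 y ((hmem y).2 ⟨by linarith, h2⟩))
  have left : ∀ a b ρ β : ℝ, 0 < a → 0 < b → 0 ≤ ρ → IsOptimal p (corrGains a b ρ) β →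
      ∀ y, p.ε * p.nsr a ≤ y → y < β → 0 ≤ rateSlope (p.nsr a) (p.nsr b) ρ y β := by
    intro a b ρ β ha hb hρ ho y h1 h2
    have hmem := fun x => mem_feasible_corrGains (β := x) hP hσ hR ha hb hρ
    have hu := ((hmem β).1 ho.1).2
    have h0 : 0 < p.ε * p.nsr a := mul_pos hε (Params.nsr_pos hP hσ ha)
    exact (sumRate_le_iff_rateSlope_nonpos hP hσ ha hb hρ (by linarith) h2
      (hu.trans (betaTop_le_one _ _ _ _))).2.1 (ho.2 y ((hmem y).2 ⟨h1, by linarith⟩))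
  intro a b ρ a' b' ρ' β β' ha hb hρ hρ1 ha' hb' hρ' hρ1' hopt hopt'
  obtain ⟨hl, hu⟩ := (mem_feasible_corrGains hP hσ hR ha hb hρ).1 hopt.1
  obtain ⟨hl', hu'⟩ := (mem_feasible_corrGains hP hσ hR ha' hb' hρ').1 hopt'.1
  exact rateSlope_argmax_sub_le hε (Params.nsr_pos hP hσ ha) (Params.nsr_pos hP hσ hb)
    (Params.nsr_pos hP hσ ha') (Params.nsr_pos hP hσ hb') hρ hρ1 hρ' hρ1' hl hu hl' hu'
    (right _ _ _ _ ha hb hρ hopt) (left _ _ _ _ ha hb hρ hopt)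
    (right _ _ _ _ ha' hb' hρ' hopt') (left _ _ _ _ ha' hb' hρ' hopt')

/-! ### Rayleigh vectors: unitary invariance and moments. -/

instance isProbabilityMeasure_complexGaussian : IsProbabilityMeasure complexGaussian := by
  unfold complexGaussian
  exact Measure.isProbabilityMeasure_map (Complex.measurableEquivRealProd.symm.measurable.aemeasurable)

instance isProbabilityMeasure_rayleigh (N : ℕ) : IsProbabilityMeasure (rayleigh N) := by
  unfold rayleigh
  exact Measure.isProbabilityMeasure_map (by fun_prop)

lemma measurable_normalize (N : ℕ) :
    Measurable fun g : Vec N => ((‖g‖⁻¹ : ℝ) : ℂ) • g := by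
  fun_prop

instance isProbabilityMeasure_isotropic (N : ℕ) : IsProbabilityMeasure (isotropic N) := by
  unfold isotropic
  exact Measure.isProbabilityMeasure_map (measurable_normalize N).aemeasurable

lemma measurable_complex_mk : Measurable fun p : ℝ × ℝ => (⟨p.1, p.2⟩ : ℂ) :=
  Complex.measurableEquivRealProd.symm.measurable

lemma charFun_complexGaussian (t : ℂ) :
    charFun complexGaussian t = Complex.exp (-(‖t‖ ^ 2 : ℝ) / 4) := by
  have h : charFun complexGaussian t =
      charFun (gaussianReal 0 (1 / 2)) t.re * charFun (gaussianReal 0 (1 / 2)) t.im := by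
    rw [charFun_apply, complexGaussian, integral_map measurable_complex_mk.aemeasurable
      (by fun_prop), charFun_apply, charFun_apply, ← integral_prod_mul]
    congr 1
    ext x
    rw [← Complex.exp_add]
    congr 1
    simp [Complex.inner]
    ring
  rw [h, charFun_gaussianReal, charFun_gaussianReal, ← Complex.exp_add, Complex.sq_norm,
    Complex.normSq_apply]
  congr 1
  push_cast
  ring

lemma charFun_rayleigh (N : ℕ) (t : Vec N) :
    charFun (rayleigh N) t = Complex.exp (-(‖t‖ ^ 2 : ℝ) / 4) := by
  rw [rayleigh, charFun_pi]
  simp_rw [charFun_complexGaussian]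
  rw [← Complex.exp_sum, EuclideanSpace.norm_sq_eq, ← Finset.sum_div, Finset.sum_neg_distrib]
  push_cast
  rfl

/-- Identifies the law as Gaussian on the underlying real space, which gives finite moments of every
order. -/
lemma rayleigh_eq_map_stdGaussian (N : ℕ) :
    rayleigh N = (stdGaussian (Vec N)).map ((√2)⁻¹ • ContinuousLinearMap.id ℝ (Vec N)) := by
  have : IsProbabilityMeasure ((stdGaussian (Vec N)).map
      ((√2)⁻¹ • ContinuousLinearMap.id ℝ (Vec N))) :=
    Measure.isProbabilityMeasure_map (by fun_prop)
  apply Measure.ext_of_charFun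
  ext t
  rw [charFun_rayleigh]
  have h := charFun_map_smul (μ := stdGaussian (Vec N)) (√2)⁻¹ t
  have e : (fun x : Vec N => (√2)⁻¹ • x) = ⇑((√2)⁻¹ • ContinuousLinearMap.id ℝ (Vec N)) := by
    ext; simp
  rw [e] at h
  rw [h, charFun_stdGaussian, norm_smul, Real.norm_of_nonneg (by positivity)]
  congr 1
  have h2 : ((√2)⁻¹) ^ 2 = (1 / 2 : ℝ) := by rw [inv_pow, Real.sq_sqrt (by norm_num)]; norm_num
  rw [← Complex.ofReal_pow, mul_pow, h2]
  push_cast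
  ring

instance isGaussian_rayleigh (N : ℕ) : IsGaussian (rayleigh N) := by
  rw [rayleigh_eq_map_stdGaussian]; infer_instance

lemma rayleigh_map_isometry {N : ℕ} (U : Vec N ≃ₗᵢ[ℂ] Vec N) :
    (rayleigh N).map U = rayleigh N := by
  have : IsProbabilityMeasure ((rayleigh N).map U) :=
    Measure.isProbabilityMeasure_map (by fun_prop)
  apply Measure.ext_of_charFun
  ext t
  have h : charFun ((rayleigh N).map U) t = charFun (rayleigh N) (U.symm t) := by
    rw [charFun_apply, charFun_apply, integral_map (by fun_prop) (by fun_prop)]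
    congr 1
    ext x
    have : inner ℝ (U x) t = inner ℝ x (U.symm t) := by
      have h1 : inner ℂ (U x) t = inner ℂ x (U.symm t) := by
        rw [← U.inner_map_map x, U.apply_symm_apply]
      have h2 := congrArg Complex.re h1
      simpa [PiLp.inner_apply, Complex.inner] using h2
    rw [this]
  rw [h, charFun_rayleigh, charFun_rayleigh, LinearIsometryEquiv.norm_map]

/-- Extend `u` to an orthonormal basis in which it has index `i` and take coordinates. -/
lemma exists_isometry_apply_eq_inner {N : ℕ} (i : Fin N) {u : Vec N} (hu : ‖u‖ = 1) :
    ∃ U : Vec N ≃ₗᵢ[ℂ] Vec N, ∀ x, U x i = inner ℂ u x := by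
  have ho : Orthonormal ℂ (({i} : Set (Fin N)).domRestrict fun _ => u) := by
    constructor
    · intro; simpa using hu
    · rintro ⟨a, ha⟩ ⟨b, hb⟩ hab
      exact absurd (Subtype.ext (ha.trans hb.symm)) hab
  obtain ⟨b, hb⟩ := ho.exists_orthonormalBasis_extension_of_card_eq (by simp)
  refine ⟨b.repr, fun x => ?_⟩
  rw [b.repr_apply_apply, hb i rfl]

/-- Averages of functions of a Rayleigh vector and its component along a unit vector `u` do not
depend on `u`. -/
lemma lintegral_rayleigh_inner {N : ℕ} (i : Fin N) {u : Vec N} (hu : ‖u‖ = 1)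
    {f : ℂ → ℝ → ENNReal} (hf : Measurable (Function.uncurry f)) :
    ∫⁻ g, f (inner ℂ u g) ‖g‖ ∂rayleigh N = ∫⁻ g, f (g i) ‖g‖ ∂rayleigh N := by
  obtain ⟨U, hU⟩ := exists_isometry_apply_eq_inner i hu
  have hm : Measurable fun g : Vec N => f (g i) ‖g‖ :=
    hf.comp (Measurable.prodMk (by fun_prop) (by fun_prop))
  conv_rhs => rw [← rayleigh_map_isometry U, lintegral_map hm (by fun_prop)]
  simp only [hU, LinearIsometryEquiv.norm_map]

lemma rayleigh_inner_mem {N : ℕ} (i : Fin N) {u : Vec N} (hu : ‖u‖ = 1)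
    {s : Set (ℂ × ℝ)} (hs : MeasurableSet s) :
    rayleigh N {g | (inner ℂ u g, ‖g‖) ∈ s} = rayleigh N {g | (g i, ‖g‖) ∈ s} := by
  have h := lintegral_rayleigh_inner i hu (f := fun z r => s.indicator 1 (z, r))
    (measurable_one.indicator hs)
  have hm1 : MeasurableSet {g : Vec N | (inner ℂ u g, ‖g‖) ∈ s} :=
    hs.preimage (Measurable.prodMk (by fun_prop) (by fun_prop))
  have hm2 : MeasurableSet {g : Vec N | (g i, ‖g‖) ∈ s} :=
    hs.preimage (Measurable.prodMk (by fun_prop) (by fun_prop))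
  rw [← lintegral_indicator_one hm1, ← lintegral_indicator_one hm2]
  exact h

lemma lintegral_one_add_norm_sq_pow_lt_top (N : ℕ) {k : ℕ} (hk : k ≠ 0) :
    ∫⁻ g, ENNReal.ofReal ((1 + ‖g‖ ^ 2) ^ k) ∂rayleigh N < ⊤ := by
  have h : MemLp (fun g : Vec N => 1 + ‖g‖) ((2 * k : ℕ) : ENNReal) (rayleigh N) :=
    (memLp_const (1 : ℝ)).add (IsGaussian.memLp_id (rayleigh N) _ (ENNReal.natCast_ne_top _)).norm
  have h2 := h.integrable_norm_pow (by simpa using hk)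
  refine lt_of_le_of_lt (lintegral_mono fun g => ?_) h2.2
  rw [← ofReal_norm]
  refine ENNReal.ofReal_le_ofReal ?_
  have h0 := norm_nonneg g
  rw [norm_pow, norm_norm, Real.norm_of_nonneg (by positivity), pow_mul]
  exact pow_le_pow_left₀ (by positivity) (by nlinarith) k

/-! ### Random vector quantization: the angle to the best codeword. -/

/-- The sine of the angle between the complex lines spanned by `h` and a unit vector `w`. -/
noncomputable def sinAngle {N : ℕ} (h w : Vec N) : ℝ := √(1 - gain h w / ‖h‖ ^ 2)

lemma gain_nonneg {N : ℕ} (h w : Vec N) : 0 ≤ gain h w := sq_nonneg _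

lemma sinAngle_nonneg {N : ℕ} (h w : Vec N) : 0 ≤ sinAngle h w := Real.sqrt_nonneg _

lemma sinAngle_le_one {N : ℕ} (h w : Vec N) : sinAngle h w ≤ 1 := by
  have : 0 ≤ gain h w / ‖h‖ ^ 2 := div_nonneg (gain_nonneg h w) (sq_nonneg _)
  rw [sinAngle, Real.sqrt_le_left zero_le_one]
  linarith

lemma measurable_sinAngle_right {N : ℕ} (h : Vec N) : Measurable (sinAngle h) := by
  unfold sinAngle gain
  fun_prop

lemma exists_le_gaussianReal_Icc :
    ∃ κ : ℝ, 0 < κ ∧ ∀ s : ℝ, 0 ≤ s → s ≤ 1 →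
      ENNReal.ofReal (κ * s) ≤ gaussianReal 0 (1 / 2) (Set.Icc (-s) s) := by
  -- On `[-s, s]`, an interval of length `2 * s`, the density is at least its value at `1`.
  refine ⟨gaussianPDFReal 0 (1 / 2) 1 * 2, by
    have := gaussianPDFReal_pos 0 (1 / 2) 1 (by norm_num); positivity, fun s hs hs1 => ?_⟩
  rw [gaussianReal_apply 0 (by norm_num)]
  have h0 := (gaussianPDFReal_pos 0 (1 / 2) 1 (by norm_num)).le
  calc ENNReal.ofReal (gaussianPDFReal 0 (1 / 2) 1 * 2 * s)
      = ∫⁻ _ in Set.Icc (-s) s, gaussianPDF 0 (1 / 2) 1 := by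
        rw [setLIntegral_const, Real.volume_Icc, gaussianPDF, ← ENNReal.ofReal_mul h0]
        congr 1; ring
    _ ≤ _ := by
        refine setLIntegral_mono' measurableSet_Icc fun x hx => ?_
        refine ENNReal.ofReal_le_ofReal ?_
        unfold gaussianPDFReal
        have : x ^ 2 ≤ 1 := by
          rw [Set.mem_Icc] at hx
          nlinarith
        have h2 : (x - 0) ^ 2 ≤ (1 - 0 : ℝ) ^ 2 := by simpa using this
        gcongr

lemma exists_le_complexGaussian_closedBall :
    ∃ κ : ℝ, 0 < κ ∧ ∀ s : ℝ, 0 ≤ s → s ≤ 1 →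
      ENNReal.ofReal ((κ * s) ^ 2) ≤ complexGaussian {z | ‖z‖ ≤ s} := by
  obtain ⟨κ, hκ, h⟩ := exists_le_gaussianReal_Icc
  refine ⟨κ / 2, by positivity, fun s hs hs1 => ?_⟩
  -- The square of half-side `s / 2` lies in the disc of radius `s`.
  have hs2 := h (s / 2) (by linarith) (by linarith)
  rw [complexGaussian, Measure.map_apply measurable_complex_mk
    (measurableSet_le (by fun_prop) (by fun_prop))]
  calc ENNReal.ofReal ((κ / 2 * s) ^ 2)
      = ENNReal.ofReal (κ * (s / 2)) * ENNReal.ofReal (κ * (s / 2)) := by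
        rw [← ENNReal.ofReal_mul (by positivity)]; congr 1; ring
    _ ≤ _ := mul_le_mul' hs2 hs2
    _ = ((gaussianReal 0 (1 / 2)).prod (gaussianReal 0 (1 / 2)))
          (Set.Icc (-(s / 2)) (s / 2) ×ˢ Set.Icc (-(s / 2)) (s / 2)) := (Measure.prod_prod _ _).symm
    _ ≤ _ := by
        refine measure_mono fun x hx => ?_
        obtain ⟨h1, h2⟩ := hx
        have h3 := Complex.norm_le_abs_re_add_abs_im ⟨x.1, x.2⟩
        have h4 := abs_le.2 h1
        have h5 := abs_le.2 h2
        simp only [Set.mem_preimage, Set.mem_ofPred_eq]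
        simp only at h3
        linarith

lemma complexGaussian_one_le_norm_pos : 0 < complexGaussian {z | 1 ≤ ‖z‖} := by
  rw [complexGaussian, Measure.map_apply measurable_complex_mk
    (measurableSet_le (by fun_prop) (by fun_prop))]
  have h1 : gaussianReal 0 (1 / 2) (Set.Ioi 1) ≠ 0 := fun h => by
    have := gaussianReal_absolutelyContinuous' 0 (v := 1 / 2) (by norm_num) h
    simp at this
  refine lt_of_lt_of_le ?_ (measure_mono (s := Set.Ioi 1 ×ˢ Set.univ) fun x hx => ?_)
  · rw [Measure.prod_prod, measure_univ, mul_one]; exact pos_iff_ne_zero.2 h1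
  · have h3 := Complex.abs_re_le_norm ⟨x.1, x.2⟩
    simp only [Set.mem_preimage, Set.mem_ofPred_eq]
    simp only [Set.mem_prod, Set.mem_Ioi, Set.mem_univ, and_true] at hx
    exact hx.le.trans ((le_abs_self _).trans h3)

/-- A Rayleigh vector makes an angle of sine at most `t` with the `i`-th axis with probability at
least of the order of `t ^ (2 (N - 1))`. -/
lemma exists_le_rayleigh_cone {N : ℕ} (i : Fin N) :
    ∃ κ : ℝ, 0 < κ ∧ ∀ t : ℝ, 0 < t → t ≤ 1 →
      ENNReal.ofReal (κ * t ^ (2 * (N - 1))) ≤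
        rayleigh N {g | (1 - t ^ 2) * ‖g‖ ^ 2 ≤ ‖g i‖ ^ 2 ∧ 0 < ‖g‖} := by
  obtain ⟨κ, hκ, h⟩ := exists_le_complexGaussian_closedBall
  have hN : 0 < (N : ℝ) := by exact_mod_cast i.pos
  have hN1 : (1 : ℝ) ≤ N := by exact_mod_cast i.pos
  set q := (complexGaussian {z | 1 ≤ ‖z‖}).toReal with hq
  have hq0 : 0 < q := ENNReal.toReal_pos complexGaussian_one_le_norm_pos.ne' (measure_ne_top _ _)
  refine ⟨q * (κ / √N) ^ (2 * (N - 1)), by positivity, fun t ht ht1 => ?_⟩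
  set s := t / √N with hs
  have hs0 : 0 < s := by positivity
  have hs1 : s ≤ 1 := (div_le_self ht.le (Real.one_le_sqrt.2 hN1)).trans ht1
  have hst : N * s ^ 2 = t ^ 2 := by
    rw [hs, div_pow, Real.sq_sqrt hN.le]; field_simp
  -- On this product event coordinate `i` has modulus at least `1` and the squares of the others sum
  -- to at most `N * s ^ 2 = t ^ 2`, so the vector lies in the cone. Each of the `N - 1` small
  -- coordinates contributes a factor of order `t ^ 2`.
  let A : Fin N → Set ℂ := fun k => if k = i then {z | 1 ≤ ‖z‖} else {z | ‖z‖ ≤ s}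
  have hm : MeasurableSet {g : Vec N | (1 - t ^ 2) * ‖g‖ ^ 2 ≤ ‖g i‖ ^ 2 ∧ 0 < ‖g‖} := by
    rw [Set.ofPred_and]
    exact (measurableSet_le (by fun_prop) (by fun_prop)).inter
      (measurableSet_lt (by fun_prop) (by fun_prop))
  rw [rayleigh, Measure.map_apply (by fun_prop) hm]
  calc ENNReal.ofReal (q * (κ / √N) ^ (2 * (N - 1)) * t ^ (2 * (N - 1)))
      = ENNReal.ofReal q * ENNReal.ofReal ((κ * s) ^ 2) ^ (N - 1) := by
        rw [← ENNReal.ofReal_pow (by positivity), ← ENNReal.ofReal_mul hq0.le]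
        congr 1
        rw [mul_assoc, ← mul_pow, ← pow_mul, hs]
        congr 2; ring
    _ ≤ complexGaussian {z | 1 ≤ ‖z‖} * complexGaussian {z | ‖z‖ ≤ s} ^ (N - 1) := by
        rw [hq, ENNReal.ofReal_toReal (measure_ne_top _ _)]
        gcongr
        exact h s hs0.le hs1
    _ = ∏ k, complexGaussian (A k) := by
        rw [← Finset.mul_prod_erase Finset.univ _ (Finset.mem_univ i),
          Finset.prod_congr rfl (g := fun _ => complexGaussian {z | ‖z‖ ≤ s})
            (fun k hk => by simp [A, (Finset.mem_erase.1 hk).1])]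
        simp [A]
    _ = Measure.pi (fun _ => complexGaussian) (Set.univ.pi A) := (Measure.pi_pi _ _).symm
    _ ≤ _ := by
        refine measure_mono fun z hz => ?_
        rw [Set.mem_univ_pi] at hz
        have hi : 1 ≤ ‖z i‖ := by simpa [A] using hz i
        have hk : ∀ k ∈ Finset.univ.erase i, ‖z k‖ ^ 2 ≤ s ^ 2 := fun k hk =>
          pow_le_pow_left₀ (norm_nonneg _) (by simpa [A, (Finset.mem_erase.1 hk).1] using hz k) 2
        have hsum : ‖WithLp.toLp 2 z‖ ^ 2 = ‖z i‖ ^ 2 + ∑ k ∈ Finset.univ.erase i, ‖z k‖ ^ 2 := by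
          rw [EuclideanSpace.norm_sq_eq, Finset.add_sum_erase Finset.univ (fun k => ‖z k‖ ^ 2)
            (Finset.mem_univ i)]
        have hle : ∑ k ∈ Finset.univ.erase i, ‖z k‖ ^ 2 ≤ t ^ 2 := by
          refine (Finset.sum_le_card_nsmul _ _ _ hk).trans ?_
          rw [nsmul_eq_mul, ← hst]
          gcongr
          exact_mod_cast (Finset.card_le_univ _).trans (by simp)
        have h0 : 0 ≤ ∑ k ∈ Finset.univ.erase i, ‖z k‖ ^ 2 := by positivity
        have hi2 : 1 ≤ ‖z i‖ ^ 2 := one_le_pow₀ hi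
        have hpos : 1 ≤ ‖WithLp.toLp 2 z‖ ^ 2 := by rw [hsum]; linarith
        refine ⟨?_, ?_⟩
        · simp only
          nlinarith
        · by_contra hc
          rw [le_antisymm (not_lt.1 hc) (norm_nonneg _)] at hpos
          norm_num at hpos

lemma gain_normalize {N : ℕ} (h g : Vec N) :
    gain h (((‖g‖⁻¹ : ℝ) : ℂ) • g) = ‖inner ℂ h g‖ ^ 2 / ‖g‖ ^ 2 := by
  rw [gain, inner_smul_right, norm_mul, Complex.norm_real, norm_inv, norm_norm]
  ring

/-- An isotropic vector makes an angle of sine at most `t` with `h` with probability at least of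
the order of `t ^ (2 (N - 1))`. -/
lemma exists_le_isotropic_sinAngle {N : ℕ} (hN : 0 < N) :
    ∃ κ : ℝ, 0 < κ ∧ ∀ h : Vec N, h ≠ 0 → ∀ t : ℝ, 0 < t → t ≤ 1 →
      ENNReal.ofReal (κ * t ^ (2 * (N - 1))) ≤ isotropic N {w | sinAngle h w ≤ t} := by
  obtain ⟨κ, hκ, H⟩ := exists_le_rayleigh_cone (⟨0, hN⟩ : Fin N)
  refine ⟨κ, hκ, fun h hh t ht ht1 => (H t ht ht1).trans ?_⟩
  have hh0 : 0 < ‖h‖ := norm_pos_iff.2 hh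
  have hu : ‖((‖h‖⁻¹ : ℝ) : ℂ) • h‖ = 1 := by
    rw [norm_smul, Complex.norm_real, norm_inv, norm_norm, inv_mul_cancel₀ hh0.ne']
  have hs : MeasurableSet {x : ℂ × ℝ | (1 - t ^ 2) * x.2 ^ 2 ≤ ‖x.1‖ ^ 2 ∧ 0 < x.2} := by
    rw [Set.ofPred_and]
    exact (measurableSet_le (by fun_prop) (by fun_prop)).inter
      (measurableSet_lt (by fun_prop) (by fun_prop))
  have e := rayleigh_inner_mem (⟨0, hN⟩ : Fin N) hu hs
  simp only [Set.mem_ofPred_eq] at e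
  have hm : MeasurableSet {w | sinAngle h w ≤ t} :=
    measurableSet_le (measurable_sinAngle_right h) measurable_const
  rw [← e, isotropic, Measure.map_apply (measurable_normalize N) hm]
  refine measure_mono fun g hg => ?_
  obtain ⟨h1, h2⟩ := hg
  rw [inner_smul_left, norm_mul, RCLike.norm_conj, Complex.norm_real, norm_inv, norm_norm,
    mul_pow, inv_pow, ← div_eq_inv_mul] at h1
  simp only [Set.mem_preimage, Set.mem_ofPred_eq, sinAngle]
  rw [Real.sqrt_le_left ht.le, gain_normalize, div_right_comm]
  rw [← le_div_iff₀ (by positivity)] at h1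
  linarith

lemma integrableOn_exp_neg_mul_rpow {q b : ℝ} (hq : 0 < q) (hb : 0 < b) :
    IntegrableOn (fun x : ℝ => Real.exp (-b * x ^ q)) (Set.Ioi 0) := by
  simpa using integrableOn_rpow_mul_exp_neg_mul_rpow (s := 0) (by norm_num) hq hb

lemma exists_isotropic_lt_sinAngle_le {N : ℕ} (hN : 0 < N) :
    ∃ κ : ℝ, 0 < κ ∧ ∀ h : Vec N, h ≠ 0 → ∀ t : ℝ, 0 < t →
      isotropic N {w | t < sinAngle h w} ≤
        ENNReal.ofReal (Real.exp (-(κ * t ^ (2 * ((N : ℝ) - 1))))) := by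
  obtain ⟨κ, hκ, H⟩ := exists_le_isotropic_sinAngle hN
  have hqn : 2 * ((N : ℝ) - 1) = ((2 * (N - 1) : ℕ) : ℝ) := by
    rw [Nat.cast_mul, Nat.cast_sub hN]; norm_num
  refine ⟨κ, hκ, fun h hh t ht => ?_⟩
  rcases le_or_gt t 1 with h1 | h1
  · have hm : MeasurableSet {w | sinAngle h w ≤ t} :=
      measurableSet_le (measurable_sinAngle_right h) measurable_const
    have e : {w | t < sinAngle h w} = {w | sinAngle h w ≤ t}ᶜ := by ext; simp
    rw [e, prob_compl_eq_one_sub hm]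
    refine (tsub_le_tsub_left (H h hh t ht h1) 1).trans ?_
    rw [← ENNReal.ofReal_one, ← ENNReal.ofReal_sub _ (by positivity), hqn, Real.rpow_natCast]
    refine ENNReal.ofReal_le_ofReal ?_
    -- The bound `1 - x ≤ exp (-x)` makes the tail multiplicative in the number of codewords.
    have := Real.add_one_le_exp (-(κ * t ^ (2 * (N - 1))))
    linarith
  · have e : {w | t < sinAngle h w} = ∅ := by
      ext w; simpa using (sinAngle_le_one h w).trans h1.le
    simp [e]

lemma pi_lt_iInf_le {E : Type*} [MeasurableSpace E] (μ : Measure E) [SigmaFinite μ] (M : ℕ)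
    (f : E → ℝ) (t : ℝ) :
    (Measure.pi fun _ : Fin M => μ) {c | t < ⨅ j, f (c j)} ≤ μ {w | t < f w} ^ M := by
  calc _ ≤ (Measure.pi fun _ : Fin M => μ) (Set.univ.pi fun _ => {w | t < f w}) := by
        refine measure_mono fun c hc => ?_
        rw [Set.mem_univ_pi]
        intro j
        have h : ⨅ j, f (c j) ≤ f (c j) := ciInf_le (Set.finite_range _).bddBelow j
        exact lt_of_lt_of_le hc h
    _ = _ := by simp [Measure.pi_pi]

/-- The angle to the closest of `M` independent isotropic vectors is of the order of
`M ^ (-1 / (2 (N - 1)))` on average. -/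
lemma exists_lintegral_iInf_sinAngle_le {N : ℕ} (hN : 2 ≤ N) :
    ∃ C : ℝ, 0 < C ∧ ∀ h : Vec N, h ≠ 0 → ∀ M : ℕ, 0 < M →
      ∫⁻ c, ENNReal.ofReal (⨅ j, sinAngle h (c j)) ∂(Measure.pi fun _ : Fin M => isotropic N) ≤
        ENNReal.ofReal (C * (M : ℝ) ^ (-1 / (2 * ((N : ℝ) - 1)))) := by
  obtain ⟨κ, hκ, H⟩ := exists_isotropic_lt_sinAngle_le (N := N) (by omega)
  have hN' : (2 : ℝ) ≤ N := by exact_mod_cast hN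
  have hq : 0 < 2 * ((N : ℝ) - 1) := by linarith
  generalize 2 * ((N : ℝ) - 1) = q at *
  have hG : 0 < Real.Gamma (1 / q + 1) := Real.Gamma_pos_of_pos (by positivity)
  -- This is the integral of `exp (-M * κ * t ^ q)` over `t > 0`, with the factor `M ^ (-1 / q)`
  -- taken out.
  refine ⟨κ ^ (-1 / q) * Real.Gamma (1 / q + 1), by positivity, fun h hh M hM => ?_⟩
  have hM' : 0 < (M : ℝ) := by exact_mod_cast hM
  have hb : 0 < M * κ := by positivity
  have hmeas : Measurable fun c : Fin M → Vec N => ⨅ j, sinAngle h (c j) :=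
    Measurable.iInf fun j => (measurable_sinAngle_right h).comp (measurable_pi_apply j)
  have hnn : ∀ c : Fin M → Vec N, 0 ≤ ⨅ j, sinAngle h (c j) := fun c =>
    Real.iInf_nonneg fun j => sinAngle_nonneg h (c j)
  rw [lintegral_eq_lintegral_meas_lt _ (ae_of_all _ hnn) hmeas.aemeasurable]
  calc ∫⁻ t in Set.Ioi (0 : ℝ), (Measure.pi fun _ : Fin M => isotropic N)
        {c | t < ⨅ j, sinAngle h (c j)}
      ≤ ∫⁻ t in Set.Ioi (0 : ℝ), ENNReal.ofReal (Real.exp (-(M * κ) * t ^ q)) := by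
        refine setLIntegral_mono' measurableSet_Ioi fun t ht => ?_
        refine (pi_lt_iInf_le _ M _ t).trans ((pow_le_pow_left' (H h hh t ht) M).trans_eq ?_)
        rw [← ENNReal.ofReal_pow (Real.exp_pos _).le, ← Real.exp_nat_mul]
        congr 2; ring
    _ = ENNReal.ofReal (∫ t in Set.Ioi (0 : ℝ), Real.exp (-(M * κ) * t ^ q)) := by
        rw [ofReal_integral_eq_lintegral_ofReal (integrableOn_exp_neg_mul_rpow hq hb)
          (ae_of_all _ fun _ => (Real.exp_pos _).le)]
    _ = _ := by
        rw [integral_exp_neg_mul_rpow hq hb, Real.mul_rpow hM'.le hκ.le]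
        congr 1; ring

/-! ### Negative moments of the distance between channel lines, and the integrable weight. -/

lemma rpow_le_rpow_of_nonpos {x y : ENNReal} {z : ℝ} (hxy : x ≤ y) (hz : z ≤ 0) :
    y ^ z ≤ x ^ z := by
  rw [← neg_neg z, ENNReal.rpow_neg y, ENNReal.rpow_neg x, ENNReal.inv_le_inv]
  exact ENNReal.rpow_le_rpow hxy (by linarith)

lemma lintegral_gaussianReal_enorm_rpow_lt_top {α : ℝ} (hα0 : 0 < α) (hα : α < 1) :
    ∫⁻ x, ‖x‖ₑ ^ (-α) ∂gaussianReal 0 (1 / 2) < ⊤ := by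
  have hball : IntegrableOn (fun x : ℝ => ‖x‖ ^ (-α)) (Metric.ball 0 1) volume := by
    refine integrableOn_ball_of_norm_le_rpow (C := 1) (α := α) (by simp) (by simpa using hα)
      (ae_of_all _ fun x => ?_)
      (measurable_norm.pow_const _).aestronglyMeasurable
    rw [one_mul, Real.norm_of_nonneg (by positivity)]
  have hne : ∀ᵐ x : ℝ ∂volume.restrict (Metric.ball 0 1), x ≠ 0 :=
    ae_restrict_of_ae (by simp [ae_iff])
  have hball' : ∫⁻ x in Metric.ball (0 : ℝ) 1, ‖x‖ₑ ^ (-α) < ⊤ := by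
    refine lt_of_le_of_lt (lintegral_mono_ae (hne.mono fun x hx => ?_)) hball.2
    rw [← ofReal_norm, ← ofReal_norm, ENNReal.ofReal_rpow_of_pos (norm_pos_iff.2 hx)]
    exact ENNReal.ofReal_le_ofReal (le_abs_self _)
  have hout : ∀ x ∈ (Metric.ball (0 : ℝ) 1)ᶜ, ‖x‖ₑ ^ (-α) ≤ 1 := fun x hx => by
    refine ENNReal.rpow_le_one_of_one_le_of_neg ?_ (by linarith)
    rw [← ofReal_norm, ENNReal.one_le_ofReal]
    simpa using hx
  have hpdf : ∀ x, gaussianPDF 0 (1 / 2) x ≤ gaussianPDF 0 (1 / 2) 0 := fun x => by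
    refine ENNReal.ofReal_le_ofReal ?_
    unfold gaussianPDFReal
    have : (0 - 0 : ℝ) ^ 2 ≤ (x - 0) ^ 2 := by simpa using sq_nonneg x
    gcongr
  rw [← lintegral_add_compl _ (measurableSet_ball (x := (0 : ℝ)) (ε := 1))]
  refine ENNReal.add_lt_top.2 ⟨?_, ?_⟩
  · rw [gaussianReal_of_var_ne_zero _ (by norm_num),
      setLIntegral_withDensity_eq_lintegral_mul₀ (by fun_prop) (by fun_prop)
        measurableSet_ball]
    refine lt_of_le_of_lt (lintegral_mono fun x => mul_le_mul' (hpdf x) le_rfl) ?_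
    rw [lintegral_const_mul' _ _ gaussianPDF_ne_top]
    exact ENNReal.mul_lt_top gaussianPDF_lt_top hball'
  · refine lt_of_le_of_lt (setLIntegral_mono' measurableSet_ball.compl hout) ?_
    rw [setLIntegral_one]
    exact measure_lt_top _ _

/-- Since `‖z‖ ^ 2 ≥ |re z| * |im z|`, the integrand is dominated by a product of two independent
real factors of exponent `-3/4 > -1`. -/
lemma lintegral_complexGaussian_enorm_rpow_lt_top :
    ∫⁻ z, ‖z‖ₑ ^ (-(3 / 2) : ℝ) ∂complexGaussian < ⊤ := by
  rw [complexGaussian, lintegral_map (by fun_prop) measurable_complex_mk]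
  have h : ∀ x : ℝ × ℝ, ‖(⟨x.1, x.2⟩ : ℂ)‖ₑ ^ (-(3 / 2) : ℝ) ≤
      ‖x.1‖ₑ ^ (-(3 / 4) : ℝ) * ‖x.2‖ₑ ^ (-(3 / 4) : ℝ) := by
    intro x
    rw [← ENNReal.mul_rpow_of_ne_top enorm_ne_top enorm_ne_top,
      show (-(3 / 2) : ℝ) = 2 * (-(3 / 4)) by norm_num, ENNReal.rpow_mul]
    refine rpow_le_rpow_of_nonpos ?_ (by norm_num)
    rw [ENNReal.rpow_two, ← ofReal_norm, ← ofReal_norm, ← ofReal_norm,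
      ← ENNReal.ofReal_mul (norm_nonneg _), ← ENNReal.ofReal_pow (norm_nonneg _), sq]
    exact ENNReal.ofReal_le_ofReal (mul_le_mul (Complex.abs_re_le_norm ⟨x.1, x.2⟩)
      (Complex.abs_im_le_norm ⟨x.1, x.2⟩) (norm_nonneg _) (norm_nonneg _))
  refine lt_of_le_of_lt (lintegral_mono h) ?_
  have hm : Measurable fun x : ℝ => ‖x‖ₑ ^ (-(3 / 4) : ℝ) := by fun_prop
  rw [lintegral_prod_mul (f := fun x : ℝ => ‖x‖ₑ ^ (-(3 / 4) : ℝ))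
    (g := fun x : ℝ => ‖x‖ₑ ^ (-(3 / 4) : ℝ)) hm.aemeasurable hm.aemeasurable]
  have := lintegral_gaussianReal_enorm_rpow_lt_top (α := 3 / 4) (by norm_num) (by norm_num)
  exact ENNReal.mul_lt_top this this

/-- With `N > 2` at least two coordinates remain off the axis, and the sum of their squared moduli
dominates the product of the moduli. This splits the power `-3/2` over two independent coordinates;
a single one would leave the non-integrable `‖z‖ ^ (-3)`. -/
lemma lintegral_rayleigh_axis_rpow_lt_top {N : ℕ} (hN : 2 < N) :
    ∫⁻ g : Vec N, ENNReal.ofReal (‖g‖ ^ 2 - ‖g ⟨0, by omega⟩‖ ^ 2) ^ (-(3 / 2) : ℝ) ∂rayleigh N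
      < ⊤ := by
  set i : Fin N := ⟨0, by omega⟩
  set j : Fin N := ⟨1, by omega⟩
  set k : Fin N := ⟨2, by omega⟩
  have hij : i ≠ j := by simp [i, j]
  have hik : i ≠ k := by simp [i, k]
  have hjk : j ≠ k := by simp [j, k]
  rw [rayleigh, lintegral_map (by fun_prop) (by fun_prop)]
  have hbd : ∀ z : Fin N → ℂ,
      ENNReal.ofReal (‖WithLp.toLp 2 z‖ ^ 2 - ‖z i‖ ^ 2) ^ (-(3 / 2) : ℝ) ≤
        ‖z j‖ₑ ^ (-(3 / 2) : ℝ) * ‖z k‖ₑ ^ (-(3 / 2) : ℝ) := by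
    intro z
    rw [← ENNReal.mul_rpow_of_ne_top enorm_ne_top enorm_ne_top]
    refine rpow_le_rpow_of_nonpos ?_ (by norm_num)
    rw [← ofReal_norm, ← ofReal_norm, ← ENNReal.ofReal_mul (norm_nonneg _)]
    refine ENNReal.ofReal_le_ofReal ?_
    have h1 : ∑ l ∈ ({i, j, k} : Finset (Fin N)), ‖z l‖ ^ 2 ≤ ‖WithLp.toLp 2 z‖ ^ 2 := by
      rw [EuclideanSpace.norm_sq_eq]
      exact Finset.sum_le_sum_of_subset_of_nonneg (Finset.subset_univ _)
        fun _ _ _ => sq_nonneg _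
    rw [Finset.sum_insert (by simp [hij, hik]), Finset.sum_insert (by simp [hjk]),
      Finset.sum_singleton] at h1
    nlinarith [sq_nonneg (‖z j‖ - ‖z k‖), sq_nonneg (‖z j‖ + ‖z k‖)]
  refine lt_of_le_of_lt (lintegral_mono hbd) ?_
  have hm : Measurable fun z : ℂ => ‖z‖ₑ ^ (-(3 / 2) : ℝ) := by fun_prop
  have hind := (iIndepFun_pi (μ := fun _ : Fin N => complexGaussian)
    (X := fun _ z => ‖z‖ₑ ^ (-(3 / 2) : ℝ)) fun _ => hm.aemeasurable).indepFun hjk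
  have hev : ∀ l : Fin N, ∫⁻ z : Fin N → ℂ, ‖z l‖ₑ ^ (-(3 / 2) : ℝ)
      ∂Measure.pi (fun _ => complexGaussian) < ⊤ := fun l => by
    have h := (measurePreserving_eval (fun _ : Fin N => complexGaussian) l).lintegral_comp hm
    simp only [Function.eval] at h
    rw [h]
    exact lintegral_complexGaussian_enorm_rpow_lt_top
  have hl : ∀ l : Fin N, AEMeasurable (fun z : Fin N → ℂ => ‖z l‖ₑ ^ (-(3 / 2) : ℝ))
      (Measure.pi fun _ => complexGaussian) := fun l =>
    (hm.comp (measurable_pi_apply l)).aemeasurable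
  rw [lintegral_mul_eq_lintegral_mul_lintegral_of_indepFun'' (hl j) (hl k) hind]
  exact ENNReal.mul_lt_top (hev j) (hev k)

/-- At `0` the integrand of the preceding moment is infinite. -/
lemma ae_rayleigh_ne_zero {N : ℕ} (hN : 2 < N) : ∀ᵐ g ∂rayleigh N, g ≠ 0 := by
  filter_upwards [ae_lt_top (by fun_prop) (lintegral_rayleigh_axis_rpow_lt_top hN).ne] with g hg h0
  simp [h0] at hg

/-- The squared distance of `h'` to the complex line spanned by `h`. -/
noncomputable def distSq {N : ℕ} (h h' : Vec N) : ℝ := ‖h'‖ ^ 2 - ‖inner ℂ h h'‖ ^ 2 / ‖h‖ ^ 2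

lemma measurable_distSq (N : ℕ) : Measurable (Function.uncurry (distSq (N := N))) := by
  unfold distSq Function.uncurry
  fun_prop

lemma exists_lintegral_distSq_rpow_le {N : ℕ} (hN : 2 < N) :
    ∃ C : ENNReal, C < ⊤ ∧ ∀ h : Vec N,
      ∫⁻ g, ENNReal.ofReal (distSq h g) ^ (-(3 / 2) : ℝ) ∂rayleigh N ≤ C := by
  refine ⟨_, lintegral_rayleigh_axis_rpow_lt_top hN, fun h => ?_⟩
  set i : Fin N := ⟨0, by omega⟩
  obtain ⟨u, hu, hle⟩ : ∃ u : Vec N, ‖u‖ = 1 ∧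
      ∀ g, ‖g‖ ^ 2 - ‖inner ℂ u g‖ ^ 2 ≤ distSq h g := by
    rcases eq_or_ne h 0 with rfl | hh
    -- For `h = 0` the convention `x / 0 = 0` makes `distSq h g = ‖g‖ ^ 2`, so any unit vector
    -- serves.
    · refine ⟨EuclideanSpace.single i 1, by simp, fun g => ?_⟩
      simp [distSq]
    · have hh0 : ‖h‖ ≠ 0 := norm_ne_zero_iff.2 hh
      refine ⟨((‖h‖⁻¹ : ℝ) : ℂ) • h, ?_, fun g => ?_⟩
      · rw [norm_smul, Complex.norm_real, norm_inv, norm_norm, inv_mul_cancel₀ hh0]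
      · rw [inner_smul_left, norm_mul, RCLike.norm_conj, Complex.norm_real, norm_inv, norm_norm,
          mul_pow, inv_pow, ← div_eq_inv_mul, distSq]
  have e := lintegral_rayleigh_inner i hu
    (f := fun z r => ENNReal.ofReal (r ^ 2 - ‖z‖ ^ 2) ^ (-(3 / 2) : ℝ))
    (by unfold Function.uncurry; fun_prop)
  rw [← e]
  exact lintegral_mono fun g =>
    rpow_le_rpow_of_nonpos (ENNReal.ofReal_le_ofReal (hle g)) (by norm_num)

/-- An integrable weight on pairs of channels that dominates the sensitivity of the optimal power
allocation. -/
noncomputable def weight {N : ℕ} (h h' : Vec N) : ENNReal :=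
  2 * (ENNReal.ofReal ((1 + ‖h‖ ^ 2) ^ 9) * ENNReal.ofReal ((1 + ‖h'‖ ^ 2) ^ 9)) +
    ENNReal.ofReal (distSq h h') ^ (-(3 / 2) : ℝ)

lemma measurable_weight (N : ℕ) : Measurable (Function.uncurry (weight (N := N))) := by
  have h := (measurable_distSq N)
  have e : Function.uncurry (weight (N := N)) = fun x =>
    2 * (ENNReal.ofReal ((1 + ‖x.1‖ ^ 2) ^ 9) * ENNReal.ofReal ((1 + ‖x.2‖ ^ 2) ^ 9)) +
    ENNReal.ofReal (Function.uncurry distSq x) ^ (-(3 / 2) : ℝ) := rfl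
  rw [e]
  fun_prop

lemma lintegral_weight_lt_top {N : ℕ} (hN : 2 < N) :
    ∫⁻ h, weight (h 0) (h 1) ∂(Measure.pi fun _ : Fin 2 => rayleigh N) < ⊤ := by
  have hmp := measurePreserving_finTwoArrow (rayleigh N)
  have h1 := hmp.lintegral_comp (measurable_weight N)
  have e : ∀ h : Fin 2 → Vec N,
      Function.uncurry weight (MeasurableEquiv.finTwoArrow h) = weight (h 0) (h 1) := fun h => rfl
  simp only [e] at h1
  rw [h1]
  have hd := measurable_distSq N
  have e2 : ∀ x : Vec N × Vec N, Function.uncurry weight x =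
    2 * (ENNReal.ofReal ((1 + ‖x.1‖ ^ 2) ^ 9) * ENNReal.ofReal ((1 + ‖x.2‖ ^ 2) ^ 9)) +
    ENNReal.ofReal (Function.uncurry distSq x) ^ (-(3 / 2) : ℝ) := fun x => rfl
  simp only [e2]
  rw [lintegral_add_left (by fun_prop), lintegral_const_mul _ (by fun_prop)]
  have hmom := lintegral_one_add_norm_sq_pow_lt_top N (k := 9) (by norm_num)
  obtain ⟨C, hC, hle⟩ := exists_lintegral_distSq_rpow_le hN
  refine ENNReal.add_lt_top.2 ⟨ENNReal.mul_lt_top (by simp) ?_, ?_⟩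
  · rw [lintegral_prod_mul (f := fun g : Vec N => ENNReal.ofReal ((1 + ‖g‖ ^ 2) ^ 9))
      (g := fun g : Vec N => ENNReal.ofReal ((1 + ‖g‖ ^ 2) ^ 9)) (by fun_prop) (by fun_prop)]
    exact ENNReal.mul_lt_top hmom hmom
  · rw [lintegral_prod _ (by fun_prop)]
    refine lt_of_le_of_lt (lintegral_mono fun h => hle h) ?_
    simpa using hC

/-- Young's inequality with exponents `3` and `3/2` separates the polynomial factor from `1 /
distSq`. The polynomial factor is at most `((1 + a) * (1 + b)) ^ 3`, whence the power `9` in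
`weight`; the second copy of that term absorbs the summand without `1 / distSq`. -/
lemma ofReal_mul_le_weight {N : ℕ} (h h' : Vec N) (hd : 0 < distSq h h') :
    ENNReal.ofReal ((1 + ‖h‖ ^ 2 + ‖h'‖ ^ 2) * (1 + (‖h'‖ ^ 2) ^ 2 / distSq h h')) ≤
      weight h h' := by
  set a := ‖h‖ ^ 2
  set b := ‖h'‖ ^ 2
  have ha : 0 ≤ a := sq_nonneg _
  have hb : 0 ≤ b := sq_nonneg _
  have h1a : 1 ≤ 1 + a := by linarith
  have h1b : 1 ≤ 1 + b := by linarith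
  have hab : 1 + a + b ≤ (1 + a) * (1 + b) := by nlinarith
  have e9 : ENNReal.ofReal ((1 + a) ^ 9) * ENNReal.ofReal ((1 + b) ^ 9) =
      ENNReal.ofReal (((1 + a) * (1 + b)) ^ 9) := by
    rw [← ENNReal.ofReal_mul (by positivity), mul_pow]
  have hP : 1 ≤ (1 + a) * (1 + b) := one_le_mul_of_one_le_of_one_le h1a h1b
  have hy := ENNReal.young_inequality (ENNReal.ofReal ((1 + a + b) * b ^ 2))
    (ENNReal.ofReal (distSq h h'))⁻¹ (p := 3) (q := 3 / 2)
    (Real.holderConjugate_iff.2 ⟨by norm_num, by norm_num⟩)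
  rw [weight, e9, two_mul, add_assoc (ENNReal.ofReal _)]
  calc ENNReal.ofReal ((1 + a + b) * (1 + b ^ 2 / distSq h h'))
      = ENNReal.ofReal (1 + a + b) +
          ENNReal.ofReal ((1 + a + b) * b ^ 2) * (ENNReal.ofReal (distSq h h'))⁻¹ := by
        rw [← ENNReal.ofReal_inv_of_pos hd, ← ENNReal.ofReal_mul (by positivity),
          ← ENNReal.ofReal_add (by positivity) (by positivity)]
        congr 1; ring
    _ ≤ _ := by
        refine add_le_add (ENNReal.ofReal_le_ofReal (hab.trans
          (le_self_pow₀ hP (show 9 ≠ 0 by norm_num))))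
          (hy.trans (add_le_add ?_ ?_))
        · refine ENNReal.div_le_of_le_mul ?_
          refine le_trans ?_ (le_mul_of_one_le_right' (by simp))
          rw [ENNReal.ofReal_rpow_of_nonneg (by positivity) (by norm_num)]
          refine ENNReal.ofReal_le_ofReal ?_
          rw [show (3 : ℝ) = ((3 : ℕ) : ℝ) by norm_num, Real.rpow_natCast,
            show 9 = 3 * 3 by norm_num, pow_mul]
          refine pow_le_pow_left₀ (by positivity) ?_ 3
          have hbP : b ≤ (1 + a) * (1 + b) := by nlinarith
          calc (1 + a + b) * b ^ 2 ≤ ((1 + a) * (1 + b)) * ((1 + a) * (1 + b)) ^ 2 := by gcongr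
            _ = _ := by ring
        · refine ENNReal.div_le_of_le_mul ?_
          refine le_trans ?_ (le_mul_of_one_le_right' (by
            rw [ENNReal.one_le_ofReal]; norm_num))
          rw [ENNReal.inv_rpow, ENNReal.rpow_neg]

/-! ### Correlations and angles of channels and beams. -/

section geometry

variable {N : ℕ}

/-- The squared correlation of two channel directions. -/
noncomputable def corr (h h' : Vec N) : ℝ := gain h h' / (‖h‖ ^ 2 * ‖h'‖ ^ 2)

lemma gain_comm (h w : Vec N) : gain h w = gain w h := by
  rw [gain, gain, norm_inner_symm]

lemma gain_le (h w : Vec N) : gain h w ≤ ‖h‖ ^ 2 * ‖w‖ ^ 2 := by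
  rw [gain, ← mul_pow]
  exact pow_le_pow_left₀ (norm_nonneg _) (norm_inner_le_norm h w) 2

lemma corr_nonneg (h h' : Vec N) : 0 ≤ corr h h' :=
  div_nonneg (gain_nonneg _ _) (by positivity)

lemma corr_le_one (h h' : Vec N) : corr h h' ≤ 1 :=
  div_le_one_of_le₀ (gain_le _ _) (by positivity)

lemma fullGains_eq {h : Fin 2 → Vec N} (h0 : h 0 ≠ 0) (h1 : h 1 ≠ 0) :
    fullGains h = corrGains (‖h 0‖ ^ 2) (‖h 1‖ ^ 2) (corr (h 0) (h 1)) := by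
  have n0 : ‖h 0‖ ≠ 0 := norm_ne_zero_iff.2 h0
  have n1 : ‖h 1‖ ≠ 0 := norm_ne_zero_iff.2 h1
  simp only [fullGains, corrGains, gain_normalize, corr, Gains.mk.injEq, true_and, and_true]
  constructor
  · rw [gain]; field_simp
  · rw [gain_comm, gain]; field_simp

lemma fedBackGains_eq (B : ℕ) (δ : ℝ) (h w : Fin 2 → Vec N) :
    fedBackGains B δ h w = corrGains (quantizer B δ (gain (h 0) (w 0)))
      (quantizer B δ (gain (h 1) (w 1))) (gain (w 0) (w 1)) := by
  simp only [fedBackGains, corrGains, gain_comm (w 1) (w 0)]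

lemma distSq_eq {h h' : Vec N} (h0 : h ≠ 0) (h1 : h' ≠ 0) :
    distSq h h' = ‖h'‖ ^ 2 * (1 - corr h h') := by
  have n0 : ‖h‖ ≠ 0 := norm_ne_zero_iff.2 h0
  have n1 : ‖h'‖ ≠ 0 := norm_ne_zero_iff.2 h1
  rw [distSq, corr, gain]; field_simp

lemma sq_sinAngle {h w : Vec N} (hw : ‖w‖ = 1) :
    sinAngle h w ^ 2 = 1 - gain h w / ‖h‖ ^ 2 := by
  rw [sinAngle, Real.sq_sqrt]
  have := div_le_one_of_le₀ (gain_le h w) (by positivity)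
  rw [hw, one_pow, mul_one] at this
  linarith

lemma gain_eq_of_norm_eq_one {h w : Vec N} (hh : h ≠ 0) (hw : ‖w‖ = 1) :
    gain h w = ‖h‖ ^ 2 * (1 - sinAngle h w ^ 2) := by
  have n0 : ‖h‖ ≠ 0 := norm_ne_zero_iff.2 hh
  rw [sq_sinAngle hw]; field_simp; ring

lemma abs_gain_sub_gain_le {u v w : Vec N} (hu : ‖u‖ = 1) (hv : ‖v‖ = 1) (hw : ‖w‖ = 1) :
    |gain v w - gain v u| ≤ 4 * sinAngle u w := by
  set s := sinAngle u w
  set z := inner ℂ u w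
  have hs0 : 0 ≤ s := sinAngle_nonneg u w
  have hs1 : s ≤ 1 := sinAngle_le_one u w
  have hs2 : s ^ 2 = 1 - ‖z‖ ^ 2 := by rw [sq_sinAngle hw, hu, gain]; ring
  have hz1 : ‖z‖ ≤ 1 := by nlinarith [norm_nonneg z]
  have hvu : ‖inner ℂ v u‖ ≤ 1 := by simpa [hu, hv] using norm_inner_le_norm (𝕜 := ℂ) v u
  have hvw : ‖inner ℂ v w‖ ≤ 1 := by simpa [hw, hv] using norm_inner_le_norm (𝕜 := ℂ) v w
  -- The component of `w` orthogonal to `u` has norm equal to the sine, so replacing `w` by `z • u`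
  -- costs at most `s` in the inner product with `v`.
  have hres : ‖w - z • u‖ ^ 2 = s ^ 2 := by
    rw [@norm_sub_sq ℂ, inner_smul_right, norm_smul, hu, hw, hs2, ← inner_conj_symm,
      RCLike.mul_conj]
    norm_cast
    ring
  have hres' : ‖w - z • u‖ = s := by
    exact (sq_eq_sq₀ (norm_nonneg _) hs0).1 hres
  have hdec : inner ℂ v w = z * inner ℂ v u + inner ℂ v (w - z • u) := by
    rw [inner_sub_right, inner_smul_right]; ring
  have hrem : ‖inner ℂ v (w - z • u)‖ ≤ s := by
    have := norm_inner_le_norm (𝕜 := ℂ) v (w - z • u)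
    rwa [hv, hres', one_mul] at this
  have h1 : ‖inner ℂ v w‖ ≤ ‖z‖ * ‖inner ℂ v u‖ + s := by
    rw [hdec, ← norm_mul]
    exact (norm_add_le _ _).trans (by linarith)
  have h2 : ‖z‖ * ‖inner ℂ v u‖ ≤ ‖inner ℂ v w‖ + s := by
    have e : z * inner ℂ v u = inner ℂ v w - inner ℂ v (w - z • u) := by rw [hdec]; ring
    rw [← norm_mul, e]
    exact (norm_sub_le _ _).trans (by linarith)
  have h3 : 1 - ‖z‖ ≤ s := by nlinarith [norm_nonneg z]
  have n1 := norm_nonneg (inner ℂ v u)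
  have n2 := norm_nonneg (inner ℂ v w)
  have n3 := norm_nonneg z
  have h4 : |‖inner ℂ v w‖ - ‖inner ℂ v u‖| ≤ 2 * s := by
    rw [abs_le]; constructor <;> nlinarith
  rw [gain, gain, sq_sub_sq, abs_mul, abs_of_nonneg (add_nonneg n2 n1)]
  nlinarith [abs_nonneg (‖inner ℂ v w‖ - ‖inner ℂ v u‖)]

lemma norm_normalize {h : Vec N} (hh : h ≠ 0) : ‖((‖h‖⁻¹ : ℝ) : ℂ) • h‖ = 1 := by
  rw [norm_smul, Complex.norm_real, norm_inv, norm_norm, inv_mul_cancel₀ (norm_ne_zero_iff.2 hh)]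

lemma sinAngle_normalize {h w : Vec N} (hh : h ≠ 0) :
    sinAngle (((‖h‖⁻¹ : ℝ) : ℂ) • h) w = sinAngle h w := by
  rw [sinAngle, sinAngle, norm_normalize hh, gain_comm, gain_normalize, gain_comm, gain]
  simp

/-- The two channel directions are replaced by the beams one after the other. -/
lemma abs_gain_sub_corr_le {h h' w w' : Vec N} (hh : h ≠ 0) (hh' : h' ≠ 0) (hw : ‖w‖ = 1)
    (hw' : ‖w'‖ = 1) : |corr h h' - gain w w'| ≤ 4 * (sinAngle h w + sinAngle h' w') := by
  have e : corr h h' = gain (((‖h‖⁻¹ : ℝ) : ℂ) • h) (((‖h'‖⁻¹ : ℝ) : ℂ) • h') := by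
    rw [gain_comm, gain_normalize, norm_inner_symm, ← gain, gain_normalize, corr, gain]
    field_simp
  have i1 := abs_gain_sub_gain_le (norm_normalize hh) hw' hw
  have i2 := abs_gain_sub_gain_le (norm_normalize hh') (norm_normalize hh) hw'
  rw [sinAngle_normalize hh] at i1
  rw [sinAngle_normalize hh'] at i2
  rw [gain_comm w' w, gain_comm w'] at i1
  rw [e]
  rw [abs_le] at *
  constructor <;> linarith [i1.1, i1.2, i2.1, i2.2]

end geometry

/-! ### The error in a fixed realisation. -/

lemma quantizer_spec {B : ℕ} {δ x : ℝ} (hδ : 0 < δ) (h1 : δ < x) (h2 : x < (2 ^ B - 1) * δ) :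
    0 < quantizer B δ x ∧ |x - quantizer B δ x| ≤ δ := by
  rw [quantizer, if_pos h2]
  -- The lower limit `δ < x` excludes the zero cell, so the quantized gain is positive and its
  -- noise-to-signal ratio is meaningful.
  have hfl : (1 : ℤ) ≤ ⌊x / δ⌋ := by
    rw [Int.le_floor, Int.cast_one, le_div_iff₀ hδ]; linarith
  have hfl' : (1 : ℝ) ≤ ⌊x / δ⌋ := by exact_mod_cast hfl
  have i1 := Int.floor_le (x / δ)
  have i2 := Int.lt_floor_add_one (x / δ)
  rw [le_div_iff₀ hδ] at i1
  rw [div_lt_iff₀ hδ] at i2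
  refine ⟨by positivity, ?_⟩
  rw [abs_le]
  constructor <;> nlinarith

/-- The map `a ↦ nsr a` is singular at `0`, but feasibility bounds both ratios by `1 / ε`. Here `a *
(1 - s ^ 2)` is the gain along the beam and `a'` its quantized value; the loss `a * s ^ 2`
contributes exactly `nsr a' * s ^ 2`. -/
lemma abs_nsr_sub_le {p : Params} (hP : 0 < p.P) (hσ : 0 < p.σ) (hR : 0 < p.Rth) {a a' s δ : ℝ}
    (ha : 0 < a) (ha' : 0 < a') (hδ : 0 ≤ δ) (hs0 : 0 ≤ s) (hs1 : s ≤ 1)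
    (hx : p.ε * p.nsr a ≤ 1) (hx' : p.ε * p.nsr a' ≤ 1)
    (h : |a * (1 - s ^ 2) - a'| ≤ δ) :
    |p.nsr a - p.nsr a'| ≤ (1 / p.ε ^ 2 * (p.P / p.σ ^ 2) + 1 / p.ε) * (δ + s) := by
  have hε := p.ε_pos hR
  have hX := Params.nsr_pos hP hσ ha
  have hX' := Params.nsr_pos hP hσ ha'
  have hxle : p.nsr a ≤ 1 / p.ε := by rw [le_div_iff₀ hε]; linarith
  have hxle' : p.nsr a' ≤ 1 / p.ε := by rw [le_div_iff₀ hε]; linarith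
  have e : p.nsr a - p.nsr a' =
      p.nsr a * p.nsr a' * (p.P / p.σ ^ 2) * (-(a * (1 - s ^ 2) - a')) -
        p.nsr a' * s ^ 2 := by
    simp only [Params.nsr]; field_simp; ring
  have hC : 0 < p.P / p.σ ^ 2 := by positivity
  rw [e]
  calc _ ≤ p.nsr a * p.nsr a' * (p.P / p.σ ^ 2) * |a * (1 - s ^ 2) - a'| + p.nsr a' * s ^ 2 := by
        refine (abs_sub _ _).trans ?_
        rw [abs_mul, abs_neg, abs_of_pos (by positivity : 0 < p.nsr a * p.nsr a' * (p.P / p.σ ^ 2)),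
          abs_of_nonneg (by positivity : 0 ≤ p.nsr a' * s ^ 2)]
    _ ≤ (1 / p.ε) * (1 / p.ε) * (p.P / p.σ ^ 2) * δ + 1 / p.ε * s := by
        have : s ^ 2 ≤ s := by nlinarith
        gcongr
    _ ≤ _ := by
        have i1 : 0 < 1 / p.ε := by positivity
        have i2 := mul_nonneg i1.le hδ
        have i3 : 0 ≤ 1 / p.ε ^ 2 * (p.P / p.σ ^ 2) * s := by positivity
        have e2 : 1 / p.ε * (1 / p.ε) = 1 / p.ε ^ 2 := by ring
        rw [e2]; nlinarith

lemma IsOptimal.mul_nsr_le_one {p : Params} (hP : 0 < p.P) (hσ : 0 < p.σ) (hR : 0 < p.Rth)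
    {a b ρ β : ℝ} (ha : 0 < a) (hb : 0 < b) (hρ : 0 ≤ ρ) (h : IsOptimal p (corrGains a b ρ) β) :
    p.ε * p.nsr a ≤ 1 ∧ p.ε * p.nsr b ≤ 1 ∧ 0 ≤ β ∧ β ≤ 1 := by
  obtain ⟨hl, hu⟩ := (mem_feasible_corrGains hP hσ hR ha hb hρ).1 h.1
  have h0 : 0 < p.ε * p.nsr a := mul_pos (p.ε_pos hR) (Params.nsr_pos hP hσ ha)
  have hu1 := hu.trans (betaTop_le_one _ _ _ _)
  exact ⟨by linarith, mul_le_one_of_betaTop_nonneg (p.ε_pos hR) hρ (by linarith), by linarith, hu1⟩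

lemma abs_le_of_mul_le {κ x y z t : ℝ} (hκ : 0 < κ) (hz : 0 ≤ z) (hy : κ⁻¹ ≤ y)
    (h : κ * x ≤ (1 + κ) * (z * t)) (ht : 0 ≤ t) : x ≤ z * ((1 + y) * t) := by
  have h1 : x ≤ κ⁻¹ * ((1 + κ) * (z * t)) := by
    rw [← div_eq_inv_mul, le_div_iff₀ hκ]; linarith
  have h2 : κ⁻¹ * ((1 + κ) * (z * t)) = (κ⁻¹ + 1) * (z * t) := by
    field_simp
  have h3 : 0 ≤ z * t := mul_nonneg hz ht
  nlinarith

/-- Expresses the decay rate `κ` through `distSq`, whose negative moment is finite. -/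
lemma nsr_mul_one_sub_corr {p : Params} {N : ℕ} {h h' : Vec N} (h0 : h ≠ 0) (h1 : h' ≠ 0) :
    p.nsr (‖h'‖ ^ 2) * (1 - corr h h') =
      (p.P / p.σ ^ 2 * ((‖h'‖ ^ 2) ^ 2 / distSq h h'))⁻¹ := by
  have n1 : ‖h'‖ ^ 2 ≠ 0 := pow_ne_zero 2 (norm_ne_zero_iff.2 h1)
  have e : 1 - corr h h' = distSq h h' / ‖h'‖ ^ 2 := by
    rw [distSq_eq h0 h1, mul_div_cancel_left₀ _ n1]
  rw [e, Params.nsr, mul_inv, inv_div, inv_div, div_mul_div_comm, div_mul_div_comm]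
  congr 1
  ring

/-- The mismatch between the power allocations optimised for the true and for the fed-back gains,
in a fixed realisation. -/
lemma exists_powerAllocation_sub_le {p : Params} (hP : 0 < p.P) (hσ : 0 < p.σ) (hR : 0 < p.Rth) :
    ∃ C : ℝ, 0 < C ∧ ∀ (N B : ℕ) (δ : ℝ) (h w : Fin 2 → Vec N) (β β' : ℝ), 0 < δ →
      (∀ k, ‖w k‖ = 1) → (∀ k, h k ≠ 0) → 0 < distSq (h 0) (h 1) →
      (∀ k, δ < gain (h k) (w k) ∧ gain (h k) (w k) < (2 ^ B - 1) * δ) →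
      IsOptimal p (fullGains h) β → IsOptimal p (fedBackGains B δ h w) β' →
      |β' - β| ≤ C * ((1 + (‖h 1‖ ^ 2) ^ 2 / distSq (h 0) (h 1)) *
        (δ + sinAngle (h 0) (w 0) + sinAngle (h 1) (w 1))) := by
  obtain ⟨C, hC, H⟩ := exists_isOptimal_sub_le hP hσ hR
  have hε := p.ε_pos hR
  set C₁ := 1 / p.ε ^ 2 * (p.P / p.σ ^ 2) + 1 / p.ε with hC₁
  have hC₁0 : 0 < C₁ := by positivity
  refine ⟨C * (2 * C₁ + 4) * (1 + p.P / p.σ ^ 2), by positivity, ?_⟩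
  intro N B δ h w β β' hδ hw hh hd hg ho ho'
  have n0 : 0 < ‖h 0‖ ^ 2 := by have := norm_pos_iff.2 (hh 0); positivity
  have n1 : 0 < ‖h 1‖ ^ 2 := by have := norm_pos_iff.2 (hh 1); positivity
  rw [fullGains_eq (hh 0) (hh 1)] at ho
  rw [fedBackGains_eq] at ho'
  obtain ⟨q0, q0'⟩ := quantizer_spec hδ (hg 0).1 (hg 0).2
  obtain ⟨q1, q1'⟩ := quantizer_spec hδ (hg 1).1 (hg 1).2
  set a' := quantizer B δ (gain (h 0) (w 0))
  set b' := quantizer B δ (gain (h 1) (w 1))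
  have hρw : gain (w 0) (w 1) ≤ 1 := by simpa [hw] using gain_le (w 0) (w 1)
  have f := ho.mul_nsr_le_one hP hσ hR n0 n1 (corr_nonneg _ _)
  have f' := ho'.mul_nsr_le_one hP hσ hR q0 q1 (gain_nonneg _ _)
  have hH := H _ _ _ _ _ _ β β' n0 n1 (corr_nonneg _ _) (corr_le_one _ _) q0 q1
    (gain_nonneg _ _) hρw ho ho'
  rw [gain_eq_of_norm_eq_one (hh 0) (hw 0)] at q0'
  rw [gain_eq_of_norm_eq_one (hh 1) (hw 1)] at q1'
  have d0 := abs_nsr_sub_le hP hσ hR n0 q0 hδ.le (sinAngle_nonneg _ _) (sinAngle_le_one _ _)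
    f.1 f'.1 q0'
  have d1 := abs_nsr_sub_le hP hσ hR n1 q1 hδ.le (sinAngle_nonneg _ _) (sinAngle_le_one _ _)
    f.2.1 f'.2.1 q1'
  have d2 := abs_gain_sub_corr_le (hh 0) (hh 1) (hw 0) (hw 1)
  rw [← hC₁] at d0 d1
  have s0 := sinAngle_nonneg (h 0) (w 0)
  have s1 := sinAngle_nonneg (h 1) (w 1)
  set t := δ + sinAngle (h 0) (w 0) + sinAngle (h 1) (w 1) with ht
  have ht0 : 0 < t := by positivity
  have hsum : |p.nsr (‖h 0‖ ^ 2) - p.nsr a'| + |p.nsr (‖h 1‖ ^ 2) - p.nsr b'| +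
      |corr (h 0) (h 1) - gain (w 0) (w 1)| ≤ (2 * C₁ + 4) * t := by
    have i0 := mul_le_mul_of_nonneg_left (show δ + sinAngle (h 0) (w 0) ≤ t by linarith) hC₁0.le
    have i1 := mul_le_mul_of_nonneg_left (show δ + sinAngle (h 1) (w 1) ≤ t by linarith) hC₁0.le
    linarith
  have hκ := nsr_mul_one_sub_corr (p := p) (hh 0) (hh 1)
  have hy : 0 < p.P / p.σ ^ 2 * ((‖h 1‖ ^ 2) ^ 2 / distSq (h 0) (h 1)) := by positivity
  rw [hκ] at hH
  have hH' := hH.trans (mul_le_mul_of_nonneg_left (mul_le_mul_of_nonneg_left hsum hC.le)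
    (add_nonneg zero_le_one (inv_nonneg.2 hy.le)))
  rw [← mul_assoc C] at hH'
  have hfin := abs_le_of_mul_le (inv_pos.2 hy) (by positivity) (inv_inv _).le hH' ht0.le
  refine hfin.trans ?_
  rw [mul_assoc (C * (2 * C₁ + 4))]
  refine mul_le_mul_of_nonneg_left ?_ (by positivity)
  rw [← mul_assoc]
  refine mul_le_mul_of_nonneg_right ?_ ht0.le
  have i1 : 0 < p.P / p.σ ^ 2 := by positivity
  have i2 : 0 < (‖h 1‖ ^ 2) ^ 2 / distSq (h 0) (h 1) := by positivity
  linarith [add_mul 1 (p.P / p.σ ^ 2) (1 + (‖h 1‖ ^ 2) ^ 2 / distSq (h 0) (h 1)),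
    mul_add (p.P / p.σ ^ 2) 1 ((‖h 1‖ ^ 2) ^ 2 / distSq (h 0) (h 1))]

/-! ### Averaging over channels and codebook. -/

lemma ae_isotropic_norm (N : ℕ) : ∀ᵐ w ∂isotropic N, ‖w‖ = 1 ∨ w = 0 := by
  have hm : MeasurableSet {w : Vec N | ‖w‖ = 1 ∨ w = 0} := by
    rw [Set.ofPred_or]
    exact (measurableSet_eq_fun (by fun_prop) (by fun_prop)).union
      (measurableSet_eq_fun (by fun_prop) (by fun_prop))
  rw [isotropic, ae_map_iff (measurable_normalize N).aemeasurable hm]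
  refine ae_of_all _ fun g => ?_
  rcases eq_or_ne g 0 with rfl | hg
  · right; simp
  · exact Or.inl (norm_normalize hg)

lemma ae_sampleLaw_norm (N B' : ℕ) :
    ∀ᵐ ω ∂sampleLaw N B', ∀ j, ‖ω.2 j‖ = 1 ∨ ω.2 j = 0 := by
  refine ae_all_iff.2 fun j => ?_
  have h : ∀ᵐ c ∂Measure.pi (fun _ : Fin (2 ^ B') => isotropic N), ‖c j‖ = 1 ∨ c j = 0 :=
    (Measure.quasiMeasurePreserving_eval (fun _ => isotropic N) j).ae (ae_isotropic_norm N)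
  exact Measure.quasiMeasurePreserving_snd.ae h

/-- Maximising the gain minimises the sine. The infimum on the right no longer involves the
selection `j`, which need not be measurable. -/
lemma sinAngle_precoder_le {N B' : ℕ} {j : Sample N B' → Fin 2 → Fin (2 ^ B')}
    (hj : IsMRTSelection j) (ω : Sample N B') (k : Fin 2) :
    sinAngle (ω.1 k) (precoder j ω k) ≤ ⨅ i, sinAngle (ω.1 k) (ω.2 i) := by
  refine le_ciInf fun i => Real.sqrt_le_sqrt ?_
  have := hj ω k i
  simp only [precoder]
  gcongr

lemma lintegral_sampleLaw_le {N : ℕ} (hN : 2 < N) : ∃ C : ℝ, 0 < C ∧ ∀ (B' : ℕ) (δ : ℝ), 0 ≤ δ →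
    ∫⁻ ω, weight (ω.1 0) (ω.1 1) * (ENNReal.ofReal δ +
        ENNReal.ofReal (⨅ i, sinAngle (ω.1 0) (ω.2 i)) +
        ENNReal.ofReal (⨅ i, sinAngle (ω.1 1) (ω.2 i))) ∂sampleLaw N B' ≤
      ENNReal.ofReal (C * (δ + (2 : ℝ) ^ (-(B' : ℝ) / (2 * ((N : ℝ) - 1))))) := by
  obtain ⟨C, hC, H⟩ := exists_lintegral_iInf_sinAngle_le (N := N) (by omega)
  have hW := lintegral_weight_lt_top hN
  set W := ∫⁻ h, weight (h 0) (h 1) ∂(Measure.pi fun _ : Fin 2 => rayleigh N) with hWdef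
  -- The summand `1` in the first factor keeps the constant positive; the second factor comes from
  -- `δ + 2 * C * x ≤ (1 + 2 * C) * (δ + x)`.
  refine ⟨(W.toReal + 1) * (1 + 2 * C), by positivity, fun B' δ hδ => ?_⟩
  set x : ℝ := (2 : ℝ) ^ (-(B' : ℝ) / (2 * ((N : ℝ) - 1))) with hx
  have hx0 : 0 < x := by positivity
  have hxM : ((2 ^ B' : ℕ) : ℝ) ^ (-1 / (2 * ((N : ℝ) - 1))) = x := by
    rw [hx, Nat.cast_pow, ← Real.rpow_natCast, Nat.cast_ofNat, ← Real.rpow_mul (by norm_num)]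
    congr 1; ring
  have hinner : ∀ᵐ h ∂(Measure.pi fun _ : Fin 2 => rayleigh N),
      ∫⁻ c, weight (h 0) (h 1) * (ENNReal.ofReal δ + ENNReal.ofReal (⨅ i, sinAngle (h 0) (c i)) +
        ENNReal.ofReal (⨅ i, sinAngle (h 1) (c i)))
          ∂(Measure.pi fun _ : Fin (2 ^ B') => isotropic N) ≤
      weight (h 0) (h 1) * ENNReal.ofReal (δ + 2 * (C * x)) := by
    have hae : ∀ k : Fin 2, ∀ᵐ h ∂(Measure.pi fun _ : Fin 2 => rayleigh N), h k ≠ 0 := fun k =>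
      (Measure.quasiMeasurePreserving_eval (fun _ => rayleigh N) k).ae (ae_rayleigh_ne_zero hN)
    filter_upwards [hae 0, hae 1] with h h0 h1
    have hm : ∀ k, Measurable fun c : Fin (2 ^ B') → Vec N =>
        ENNReal.ofReal (⨅ i, sinAngle (h k) (c i)) := fun k => ENNReal.measurable_ofReal.comp
      (Measurable.iInf fun i => (measurable_sinAngle_right (h k)).comp (measurable_pi_apply i))
    have hm01 : Measurable fun c : Fin (2 ^ B') → Vec N => ENNReal.ofReal δ +
        ENNReal.ofReal (⨅ i, sinAngle (h 0) (c i)) + ENNReal.ofReal (⨅ i, sinAngle (h 1) (c i)) :=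
      (measurable_const.add (hm 0)).add (hm 1)
    rw [lintegral_const_mul _ hm01,
      lintegral_add_right _ (hm 1), lintegral_add_right _ (hm 0), lintegral_const, measure_univ,
      mul_one]
    have b0 := H _ h0 (2 ^ B') (by positivity)
    have b1 := H _ h1 (2 ^ B') (by positivity)
    rw [hxM] at b0 b1
    rw [two_mul, ← add_assoc, ENNReal.ofReal_add (by positivity) (by positivity),
      ENNReal.ofReal_add (by positivity) (by positivity)]
    gcongr
  -- Only the inequality half of Tonelli's theorem is used; it asks for no joint measurability.
  refine (lintegral_prod_le _).trans ((lintegral_mono_ae hinner).trans ?_)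
  have hWle : W ≤ ENNReal.ofReal (W.toReal + 1) :=
    (ENNReal.le_ofReal_iff_toReal_le hW.ne (by positivity)).2 (by linarith)
  rw [lintegral_mul_const' _ _ ENNReal.ofReal_ne_top, ← hWdef]
  refine (mul_le_mul' hWle le_rfl).trans ?_
  rw [← ENNReal.ofReal_mul (by positivity), mul_assoc]
  refine ENNReal.ofReal_le_ofReal (mul_le_mul_of_nonneg_left ?_ (by positivity))
  nlinarith [mul_nonneg hC.le hδ]

/-- A mean over the region is bounded as soon as the integrand is bounded in each realisation by a
multiple of the integrable weight and of the quantization errors. -/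
lemma meanOn_le {N B' : ℕ} {A : Set (Sample N B')} {X : Sample N B' → ℝ}
    {j : Sample N B' → Fin 2 → Fin (2 ^ B')} (hj : IsMRTSelection j) {C δ : ℝ} (hC : 0 < C)
    (hδ : 0 < δ) (hA : ∀ ω ∈ A, ∀ k, δ < gain (ω.1 k) (precoder j ω k))
    (hX : ∀ ω ∈ A, (∀ k, ‖precoder j ω k‖ = 1) → (∀ k, ω.1 k ≠ 0) →
      0 < distSq (ω.1 0) (ω.1 1) →
      X ω ≤ C * ((1 + ‖ω.1 0‖ ^ 2 + ‖ω.1 1‖ ^ 2) *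
        (1 + (‖ω.1 1‖ ^ 2) ^ 2 / distSq (ω.1 0) (ω.1 1)) *
        (δ + sinAngle (ω.1 0) (precoder j ω 0) + sinAngle (ω.1 1) (precoder j ω 1)))) :
    meanOn A X ≤ ENNReal.ofReal C * ∫⁻ ω, weight (ω.1 0) (ω.1 1) * (ENNReal.ofReal δ +
        ENNReal.ofReal (⨅ i, sinAngle (ω.1 0) (ω.2 i)) +
        ENNReal.ofReal (⨅ i, sinAngle (ω.1 1) (ω.2 i))) ∂sampleLaw N B' := by
  rw [meanOn, ← lintegral_const_mul' _ _ ENNReal.ofReal_ne_top]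
  refine lintegral_mono_ae ?_
  filter_upwards [ae_sampleLaw_norm N B'] with ω hω
  by_cases hωA : ω ∈ A
  swap
  · simp [hωA]
  rw [Set.indicator_of_mem hωA]
  -- A zero codeword, the normalisation of the zero vector, has gain `0` and is excluded by `δ <
  -- gain`.
  have hw : ∀ k, ‖precoder j ω k‖ = 1 := fun k => by
    refine (hω (j ω k)).resolve_right fun h0 => ?_
    have := hA ω hωA k
    rw [precoder, h0] at this
    simp [gain] at this
    linarith
  have hh : ∀ k, ω.1 k ≠ 0 := fun k h0 => by
    have := hA ω hωA k
    rw [h0] at this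
    simp [gain] at this
    linarith
  rcases le_or_gt (distSq (ω.1 0) (ω.1 1)) 0 with hd | hd
  -- For collinear channels the power `-3/2` of `0` is infinite, and `δ > 0` keeps the product
  -- infinite, so the bound is trivial there.
  · have : weight (ω.1 0) (ω.1 1) = ⊤ := by
      rw [weight, ENNReal.ofReal_of_nonpos hd, ENNReal.zero_rpow_of_neg (by norm_num), add_top]
    rw [this, ENNReal.top_mul (by simp [hδ]), ENNReal.mul_top (by simpa using hC)]
    exact le_top
  have h0 := sinAngle_nonneg (ω.1 0) (precoder j ω 0)
  have h1 := sinAngle_nonneg (ω.1 1) (precoder j ω 1)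
  refine (ENNReal.ofReal_le_ofReal (hX ω hωA hw hh hd)).trans ?_
  rw [ENNReal.ofReal_mul hC.le, ENNReal.ofReal_mul (by positivity), ENNReal.ofReal_add (by positivity) h1,
    ENNReal.ofReal_add hδ.le h0]
  gcongr
  · exact ofReal_mul_le_weight _ _ hd
  · exact sinAngle_precoder_le hj ω 0
  · exact sinAngle_precoder_le hj ω 1

/-- In a fixed realisation, the power-allocation mismatch, its multiple by the total channel gain
and the induced rate change are bounded by the same weighted quantization error. -/
lemma exists_loss_le {p : Params} (hP : 0 < p.P) (hσ : 0 < p.σ) (hR : 0 < p.Rth) :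
    ∃ C : ℝ, 0 < C ∧ ∀ (N B : ℕ) (δ : ℝ) (h w : Fin 2 → Vec N) (β β' : ℝ), 0 < δ →
      (∀ k, ‖w k‖ = 1) → (∀ k, h k ≠ 0) → 0 < distSq (h 0) (h 1) →
      (∀ k, δ < gain (h k) (w k) ∧ gain (h k) (w k) < (2 ^ B - 1) * δ) →
      IsOptimal p (fullGains h) β → IsOptimal p (fedBackGains B δ h w) β' →
      ∀ T, T = C * ((1 + ‖h 0‖ ^ 2 + ‖h 1‖ ^ 2) *
        (1 + (‖h 1‖ ^ 2) ^ 2 / distSq (h 0) (h 1)) *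
        (δ + sinAngle (h 0) (w 0) + sinAngle (h 1) (w 1))) →
      |β' - β| ≤ T ∧ (‖h 0‖ ^ 2 + ‖h 1‖ ^ 2) * |β' - β| ≤ T ∧
        |sumRate p (fullGains h) β - sumRate p (fullGains h) β'| ≤ T := by
  obtain ⟨C, hC, H⟩ := exists_powerAllocation_sub_le hP hσ hR
  have hl2 : 0 < Real.log 2 := Real.log_pos (by norm_num)
  set L := p.P / (p.σ ^ 2 * Real.log 2) with hL
  have hL0 : 0 < L := by positivity
  refine ⟨C * (1 + L), by positivity, ?_⟩
  rintro N B δ h w β β' hδ hw hh hd hg ho ho' T rfl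
  have hmain := H N B δ h w β β' hδ hw hh hd hg ho ho'
  have n0 : 0 < ‖h 0‖ ^ 2 := by have := norm_pos_iff.2 (hh 0); positivity
  have n1 : 0 < ‖h 1‖ ^ 2 := by have := norm_pos_iff.2 (hh 1); positivity
  rw [fullGains_eq (hh 0) (hh 1)] at ho ⊢
  rw [fedBackGains_eq] at ho'
  have f := ho.mul_nsr_le_one hP hσ hR n0 n1 (corr_nonneg _ _)
  have f' := ho'.mul_nsr_le_one hP hσ hR (quantizer_spec hδ (hg 0).1 (hg 0).2).1
    (quantizer_spec hδ (hg 1).1 (hg 1).2).1 (gain_nonneg _ _)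
  have hrate := abs_sumRate_sub_le hP hσ n0 n1 (corr_nonneg (h 0) (h 1)) (corr_le_one _ _)
    f.2.2.1 f.2.2.2 f'.2.2.1 f'.2.2.2
  rw [abs_sub_comm β, ← hL] at hrate
  set s := (1 + (‖h 1‖ ^ 2) ^ 2 / distSq (h 0) (h 1)) *
        (δ + sinAngle (h 0) (w 0) + sinAngle (h 1) (w 1)) with hs
  have s0 := sinAngle_nonneg (h 0) (w 0)
  have s1 := sinAngle_nonneg (h 1) (w 1)
  have hs0 : 0 < s := by positivity
  rw [mul_assoc (1 + ‖h 0‖ ^ 2 + ‖h 1‖ ^ 2), ← hs]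
  set n := ‖h 0‖ ^ 2 + ‖h 1‖ ^ 2 with hn
  have hn0 : 0 < n := by positivity
  have e : C * (1 + L) * ((1 + ‖h 0‖ ^ 2 + ‖h 1‖ ^ 2) * s) =
      C * s + n * (C * s) + L * (C * s) + L * (n * (C * s)) := by rw [hn]; ring
  have i0 : 0 < C * s := by positivity
  have i1 := mul_le_mul_of_nonneg_left hmain hn0.le
  have i2 := mul_le_mul_of_nonneg_left i1 hL0.le
  have i3 : 0 < n * (C * s) := by positivity
  have i4 : 0 < L * (C * s) := by positivity
  have i5 : 0 < L * (n * (C * s)) := by positivity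
  rw [e]
  refine ⟨?_, ?_, ?_⟩ <;> linarith

end MisoNoma

/-- The power-allocation mismatch `|Δβ| = |βq - βs|`, its term `(H₁ + H₂) |Δβ|` in the rate loss
bound, and the rate change under full-CSI beamforming when `βs` is replaced by `βq` all have
expectation `O(2 ^ (-B)) + O(2 ^ (-B' / (2 (N - 1))))`. -/
theorem lemma2 (N : ℕ) (hN : 2 < N) (p : MisoNoma.Params) (hP : 0 < p.P) (hσ : 0 < p.σ)
    (hR : 0 < p.Rth) (c : ℝ) (hc : 0 < c) :
    ∃ K : ℝ, 0 < K ∧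
      ∀ (B B' : ℕ) (δ : ℝ), 0 < δ → δ ≤ c * (2 : ℝ) ^ (-(B : ℝ)) →
      ∀ (j : MisoNoma.Sample N B' → Fin 2 → Fin (2 ^ B')), MisoNoma.IsMRTSelection j →
      ∀ (βs βq : MisoNoma.Sample N B' → ℝ),
        (∀ ω ∈ MisoNoma.region p B δ j,
          MisoNoma.IsOptimal p (MisoNoma.fullGains ω.1) (βs ω)) →
        (∀ ω ∈ MisoNoma.region p B δ j,
          MisoNoma.IsOptimal p (MisoNoma.hatGains B δ j ω) (βq ω)) →
        MisoNoma.meanOn (MisoNoma.region p B δ j) (fun ω => |βq ω - βs ω|) ≤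
            ENNReal.ofReal (K * ((2 : ℝ) ^ (-(B : ℝ)) +
              (2 : ℝ) ^ (-(B' : ℝ) / (2 * ((N : ℝ) - 1))))) ∧
        MisoNoma.meanOn (MisoNoma.region p B δ j)
            (fun ω => (‖ω.1 0‖ ^ 2 + ‖ω.1 1‖ ^ 2) * |βq ω - βs ω|) ≤
            ENNReal.ofReal (K * ((2 : ℝ) ^ (-(B : ℝ)) +
              (2 : ℝ) ^ (-(B' : ℝ) / (2 * ((N : ℝ) - 1))))) ∧
        MisoNoma.meanOn (MisoNoma.region p B δ j)
            (fun ω => |MisoNoma.sumRate p (MisoNoma.fullGains ω.1) (βs ω) -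
              MisoNoma.sumRate p (MisoNoma.fullGains ω.1) (βq ω)|) ≤
            ENNReal.ofReal (K * ((2 : ℝ) ^ (-(B : ℝ)) +
              (2 : ℝ) ^ (-(B' : ℝ) / (2 * ((N : ℝ) - 1))))) := by
  obtain ⟨C₁, hC₁, H⟩ := MisoNoma.exists_loss_le hP hσ hR
  obtain ⟨C₂, hC₂, H₂⟩ := MisoNoma.lintegral_sampleLaw_le hN
  refine ⟨C₁ * (C₂ * (c + 1)), by positivity, ?_⟩
  intro B B' δ hδ hδc j hj βs βq hβs hβq
  have hA : ∀ ω ∈ MisoNoma.region p B δ j, ∀ k,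
      δ < MisoNoma.gain (ω.1 k) (MisoNoma.precoder j ω k) := fun ω hω k => (hω.2.2 k).1
  have hloss := fun ω (hω : ω ∈ MisoNoma.region p B δ j) hw hh hd =>
    H N B δ ω.1 (MisoNoma.precoder j ω) (βs ω) (βq ω) hδ hw hh hd hω.2.2 (hβs ω hω) (hβq ω hω) _ rfl
  have hx : 0 < (2 : ℝ) ^ (-(B : ℝ)) := by positivity
  have hy : 0 < (2 : ℝ) ^ (-(B' : ℝ) / (2 * ((N : ℝ) - 1))) := by positivity
  have hfin : ENNReal.ofReal C₁ * ENNReal.ofReal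
        (C₂ * (δ + (2 : ℝ) ^ (-(B' : ℝ) / (2 * ((N : ℝ) - 1))))) ≤
      ENNReal.ofReal (C₁ * (C₂ * (c + 1)) * ((2 : ℝ) ^ (-(B : ℝ)) +
        (2 : ℝ) ^ (-(B' : ℝ) / (2 * ((N : ℝ) - 1))))) := by
    rw [← ENNReal.ofReal_mul hC₁.le, mul_assoc C₁, mul_assoc C₂]
    refine ENNReal.ofReal_le_ofReal (mul_le_mul_of_nonneg_left
      (mul_le_mul_of_nonneg_left ?_ hC₂.le) hC₁.le)
    -- With `x`, `y` the two target powers, `δ ≤ c * x` gives `δ + y ≤ (c + 1) * (x + y)`.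
    nlinarith [mul_pos hc hy]
  have hbound := (mul_le_mul' le_rfl (H₂ B' δ hδ.le)).trans hfin
  exact ⟨(MisoNoma.meanOn_le hj hC₁ hδ hA fun ω hω hw hh hd =>
      (hloss ω hω hw hh hd).1).trans hbound,
    (MisoNoma.meanOn_le hj hC₁ hδ hA fun ω hω hw hh hd =>
      (hloss ω hω hw hh hd).2.1).trans hbound,
    (MisoNoma.meanOn_le hj hC₁ hδ hA fun ω hω hw hh hd =>
      (hloss ω hω hw hh hd).2.2).trans hbound⟩
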